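/- **Setting.** Let $K,D\ge 1$. For each macro-arm $k\in[K]$ let $Q_k$ be a probability distribution on $[0,1]\times\{1,\dots,D\}$ (potential reward, delay). A game with time budget $T\in\mathbb N$ proceeds in epochs $s=1,2,\dots$: based on the past, the learner chooses a pair $i_s=(k,j)\in[K]\times[D]$; the environment draws $(V_{k,s},\tau_{k,s})\sim Q_k$ independently of the past and of this choice; the learner receives the reward $r^{(s)}=V_{k,s}\mathbf 1\{\tau_{k,s}\le j\}$ and consumes $c^{(s)}=\min\{\tau_{k,s},j\}$ units of time. The number $L$ of epochs of the game is either the first $n$ with $\sum_{s\le n}c^{(s)}\ge T$ (the game runs until the budget is exhausted), or the largest $n$ with $\sum_{s\le n}c^{(s)}\le T$ (only epochs completed within the budget count); the result holds for each of the two conventions. The pseudo-regret is $$R_T=\max_{(k,j)}\mathbb E\Big[\sum_{s=1}^{L_{k,j}}r_{k,j}^{(s)}\Big]-\mathbb E\Big[\sum_{s=1}^{L}r_{i_s}^{(s)}\Big],$$ where the first term refers to the policy that always plays $(k,j)$. For a pair $(k,j)$ let $\mu^{(c)}_{k,j}=\mathbb E[\min\{\tau,j\}]$ and $\gamma_{k,j}=\mathbb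 E[V\mathbf 1\{\tau\le j\}]/\mu^{(c)}_{k,j}$ with $(V,\tau)\sim Q_k$, let $\Delta_{k,j}=\max_{(k',j')}\gamma_{k',j'}-\gamma_{k,j}$, $\alpha_j=\frac{8(j-1)}3$ and $\beta_j=\sqrt2(\sqrt{j-1}+1)$. A pair is suboptimal if $\Delta_{k,j}>0$. **Wait-UCB** plays in epoch $s$, as long as the budget is not used up, a pair that maximises (ties broken in any way) $$\hat\gamma_{k,j}(s-1)+\alpha_j\frac{\log(s-1)}{n_{k,j}(s-1)}+\beta_j\sqrt{\frac{\log(s-1)}{n_{k,j}(s-1)}},$$ where $n_{k,j}(s-1)$ is the number of pulls of $(k,j)$ in the first $s-1$ epochs, and $\hat\gamma_{k,j}(s-1)$ is the total reward collected by these pulls divided by the total time they consumed; the expression is $+\infty$ if $n_{k,j}(s-1)=0$. **Theorem (regret).** There is an absolute constant $C$ such that, for all $K,D,T$ and $(Q_k)$, the pseudo-regret of Wait-UCB satisfies the following. If some pair is suboptimal, then $$R_T\le\sum_{(k,j):\Delta_{k,j}>0}\mu^{(c)}_{k,j}\left(\frac{\big(\beta_j+\sqrt{\beta_j^2+2\Delta_{k,j}\alpha_j}\big)^2\log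 T}{\Delta_{k,j}}+C\right),$$ with $\log T$ read as $0$ for $T=0$; if no pair is suboptimal, then $R_T\le C$. The leading term is of coarser order $$\sum_{\Delta_{k,j}>0}\mu^{(c)}_{k,j}\frac{\big(\beta_j+\sqrt{\beta_j^2+2\Delta_{k,j}\alpha_j}\big)^2\log T}{\Delta_{k,j}}\le C\sum_{\Delta_{k,j}>0}\mu^{(c)}_{k,j}\frac{j\log T}{\Delta_{k,j}},$$ and, if some pair is suboptimal and $T\ge2$, also $R_T\le C\sum_{\Delta_{k,j}>0}\mu^{(c)}_{k,j}\frac{j\log T}{\Delta_{k,j}}$. Moreover, if $\Delta>0$ is a lower bound for the gaps of all suboptimal pairs, then $$\sum_{\Delta_{k,j}>0}\mu^{(c)}_{k,j}\frac{j\log T}{\Delta_{k,j}}\le\frac{KD^3}{\Delta}\log T,$$ so that $R_T\le C\,\frac{KD^3}{\Delta}\log T$ if in addition some pair is suboptimal and $T\ge2$. For a single macro-arm ($K=1$) this is $O\big((D^3/\Delta)\log T\big)$. -/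

import Mathlib

open MeasureTheory ProbabilityTheory

noncomputable section

namespace FarewellToArms

/-- A macro/micro-arm pair `(k, j)`. Macro-arms and micro-arms are indexed from `0`, so that the
element `j : Fin D` stands for the waiting time `j + 1`. -/
abbrev Arm (K D : ℕ) : Type := Fin K × Fin D

/-- A potential reward in `[0, 1]` together with a delay in `{1, …, D}`; the element `d : Fin D`
stands for the delay `d + 1`. -/
abbrev Outcome (D : ℕ) : Type := Set.Icc (0 : ℝ) 1 × Fin D

/-- The waiting time in `{1, …, D}` that an index in `Fin D` stands for. -/
def waitTime {D : ℕ} (j : Fin D) : ℕ := (j : ℕ) + 1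

/-- Reward `V · 1{τ ≤ j}` of waiting for `j` when the environment draws `z = (V, τ)`. -/
def reward {D : ℕ} (j : Fin D) (z : Outcome D) : ℝ :=
  if waitTime z.2 ≤ waitTime j then (z.1 : ℝ) else 0

/-- Time `min {τ, j}` consumed by waiting for `j` when the environment draws `z = (V, τ)`. -/
def cost {D : ℕ} (j : Fin D) (z : Outcome D) : ℕ := min (waitTime z.2) (waitTime j)

section Means

variable {K D : ℕ} (Q : Fin K → Measure (Outcome D))

/-- Mean reward of a pull of an arm pair. -/
def meanReward (a : Arm K D) : ℝ := ∫ z, reward a.2 z ∂(Q a.1)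

/-- Mean waiting time of a pull of an arm pair. -/
def meanWait (a : Arm K D) : ℝ := ∫ z, (cost a.2 z : ℝ) ∂(Q a.1)

/-- Ratio of mean reward to mean waiting time. -/
def ratio (a : Arm K D) : ℝ := meanReward Q a / meanWait Q a

/-- Gap between the largest ratio and the ratio of the given arm pair. -/
def gap (a : Arm K D) : ℝ := (⨆ b : Arm K D, ratio Q b) - ratio Q a

open Classical in
/-- The set of suboptimal arm pairs. -/
def subopt : Finset (Arm K D) := Finset.univ.filter fun a => 0 < gap Q a

end Means

/-- `α_j = 8 (j - 1) / 3`. -/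
def alpha {D : ℕ} (j : Fin D) : ℝ := 8 * ((waitTime j : ℝ) - 1) / 3

/-- `β_j = √2 (√(j - 1) + 1)`. -/
def beta {D : ℕ} (j : Fin D) : ℝ := √2 * (√((waitTime j : ℝ) - 1) + 1)

/-- The leading term `(β_j + √(β_j² + 2 Δ α_j))² log T / Δ`. -/
def leadingTerm {K D : ℕ} (Q : Fin K → Measure (Outcome D)) (T : ℕ) (a : Arm K D) : ℝ :=
  (beta a.2 + √(beta a.2 ^ 2 + 2 * gap Q a * alpha a.2)) ^ 2 * Real.log T / gap Q a

/-! Quantities along one realisation: `x s k` is the draw for macro-arm `k` in epoch `s`, and `i s`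
is the arm pair pulled in epoch `s`. Epochs are numbered from `0`, so `s` epochs have been completed
when epoch `s` begins. -/
section Path

variable {K D : ℕ} (x : ℕ → Fin K → Outcome D) (i : ℕ → Arm K D)

/-- Reward collected in epoch `s`. -/
def epochReward (s : ℕ) : ℝ := reward (i s).2 (x s (i s).1)

/-- Time consumed in epoch `s`. -/
def epochCost (s : ℕ) : ℕ := cost (i s).2 (x s (i s).1)

/-- Total time consumed in the first `n` epochs. -/
def elapsed (n : ℕ) : ℕ := ∑ s ∈ Finset.range n, epochCost x i s

/-- Number of pulls of the arm pair `a` in the first `n` epochs. -/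
def pulls (a : Arm K D) (n : ℕ) : ℕ := ((Finset.range n).filter fun s => i s = a).card

/-- Empirical ratio after `n` epochs: the total reward collected by pulls of `a` divided by the
total time consumed by pulls of `a`. -/
def ratioEst (a : Arm K D) (n : ℕ) : ℝ :=
  (∑ s ∈ Finset.range n, if i s = a then epochReward x i s else 0) /
    (∑ s ∈ Finset.range n, if i s = a then (epochCost x i s : ℝ) else 0)

/-- Upper deviation of the arm pair `a` after `n` epochs. -/
def upDev (a : Arm K D) (n : ℕ) : ℝ :=
  alpha a.2 * (Real.log n / pulls i a n) + beta a.2 * √(Real.log n / pulls i a n)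

/-- Upper confidence bound of `a` after `n` epochs; it is infinite before the first pull of `a`. -/
def ucb (a : Arm K D) (n : ℕ) : EReal :=
  if pulls i a n = 0 then ⊤ else ((ratioEst x i a n + upDev i a n : ℝ) : EReal)

/-- The arm pairs are chosen by Wait-UCB: as long as the time budget `T` is not used up, the pair
pulled maximises the upper confidence bound. Ties may be broken in any way. -/
def FollowsWaitUCB (T : ℕ) : Prop :=
  ∀ s, elapsed x i s < T → ∀ b, ucb x i b s ≤ ucb x i (i s) s

end Path

/-- The two conventions for the epoch that is running when the time budget is used up: it counts
as the last epoch of the game, or only epochs completed within the budget count. -/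
inductive StopRule where
  | untilExhausted
  | completedOnly

/-- The number `L` of epochs of the game: the first `n` with `∑_{s ≤ n} c_s ≥ T`, or the largest
`n` with `∑_{s ≤ n} c_s ≤ T`. -/
def numEpochs {K D : ℕ} (x : ℕ → Fin K → Outcome D) (i : ℕ → Arm K D) (T : ℕ) : StopRule → ℕ
  | .untilExhausted => sInf {n | T ≤ elapsed x i n}
  | .completedOnly => sSup {n | elapsed x i n ≤ T}

/-- Total reward collected in the game. -/
def gameReward {K D : ℕ} (x : ℕ → Fin K → Outcome D) (i : ℕ → Arm K D) (T : ℕ)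
    (rule : StopRule) : ℝ :=
  ∑ s ∈ Finset.range (numEpochs x i T rule), epochReward x i s

section Random

variable {K D : ℕ} {Ω : Type*} [m : MeasurableSpace Ω]

/-- `X s k` is the draw for macro-arm `k` in epoch `s`, and `ℱ s` is what has happened before epoch
`s` (earlier draws and possible internal randomness of the learner). The draw for `k` in epoch `s`
has law `Q k` and is independent of the past, and in particular of the learner's choice in
epoch `s`. -/
structure IsEnvironment (P : Measure Ω) (ℱ : Filtration ℕ m) (Q : Fin K → Measure (Outcome D))
    (X : ℕ → Fin K → Ω → Outcome D) : Prop where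
  adapted : ∀ s k, Measurable[ℱ (s + 1)] (X s k)
  law : ∀ s k, P.map (X s k) = Q k
  indep : ∀ s k, Indep (MeasurableSpace.comap (X s k) inferInstance) (ℱ s) P

/-- A learner that runs Wait-UCB with time budget `T`: its choices depend only on the past and
follow the algorithm. -/
structure IsWaitUCB (ℱ : Filtration ℕ m) (X : ℕ → Fin K → Ω → Outcome D)
    (i : ℕ → Ω → Arm K D) (T : ℕ) : Prop where
  predictable : ∀ s, Measurable[ℱ s] (i s)
  follows : ∀ ω, FollowsWaitUCB (fun s k => X s k ω) (fun s => i s ω) T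

/-- Pseudo-regret against the best constant policy. -/
def pseudoRegret (P : Measure Ω) (X : ℕ → Fin K → Ω → Outcome D) (i : ℕ → Ω → Arm K D) (T : ℕ)
    (rule : StopRule) : ℝ :=
  (⨆ a : Arm K D, ∫ ω, gameReward (fun s k => X s k ω) (fun _ => a) T rule ∂P) -
    ∫ ω, gameReward (fun s k => X s k ω) (fun s => i s ω) T rule ∂P

end Random

end FarewellToArms

end

/-! Write γ for ratios, γ* for their maximum and μ for mean waits. The noise `r - γ_a c` of a pull
of `a` has mean zero, so ratios can be treated by martingale arguments even though both the reward
and the consumed time are random.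

Upper bound for the competitor. Every policy earns at most `γ* T + 1` in expectation. A direct
optional stopping argument would pay for the overshoot of the last epoch, which can be of order `D`.
Instead, a wait that may exceed the remaining budget is compared with waiting exactly for the
remaining budget. This is again one of the pairs, so its ratio is at most γ*, and crossing the
budget costs at most one reward (`exists_reward_sub_potential_le`, `integral_gameReward_le`).

Lower bound for the learner. The epochs of the game consume at least `T`, and a pull of `a` falls
short of γ* times its consumed time by `Δ_a μ_a` in expectation. The regret is therefore at most `∑
Δ_a μ_a E[pulls of a]` up to a constant (`le_integral_gameReward_add`).

Number of pulls. If a suboptimal pair is chosen after more than `(β + √(β² + 2Δα))² log T / Δ²`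
pulls, then its estimate is too high or that of an optimal pair too low (`deviates_of_ucb_le`).
Consumed time is at least the number of pulls, so an error of the estimated ratio forces a large sum
of noise. An exponential supermartingale with a Bernstein bound, in which `β²/8` bounds the variance
and `α/4` is the scale parameter, gives probability `s⁻⁴` for each value of the pull count, hence
`s⁻³` after a union bound (`measureReal_deviates_le`). This is summable, so deviations cost a
constant number of pulls. -/

namespace FarewellToArms

/-! ### One draw -/

section Draw

variable {D : ℕ} (j : Fin D) (z : Outcome D)

lemma one_le_waitTime (j : Fin D) : 1 ≤ waitTime j := by simp [waitTime]

lemma waitTime_le (j : Fin D) : waitTime j ≤ D := j.2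

lemma one_le_cost : 1 ≤ cost j z := le_min (one_le_waitTime _) (one_le_waitTime _)

lemma cost_le : cost j z ≤ waitTime j := min_le_right _ _

lemma one_le_cost_real : (1 : ℝ) ≤ cost j z := by exact_mod_cast one_le_cost j z

lemma cost_le_real : (cost j z : ℝ) ≤ waitTime j := by exact_mod_cast cost_le j z

lemma reward_nonneg : 0 ≤ reward j z := by
  unfold reward
  split_ifs
  · exact z.1.2.1
  · exact le_rfl

lemma reward_le_one : reward j z ≤ 1 := by
  unfold reward
  split_ifs
  · exact z.1.2.2
  · exact zero_le_one

lemma measurable_reward : Measurable (reward j) := by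
  unfold reward
  refine Measurable.ite ?_ (measurable_subtype_coe.comp measurable_fst) measurable_const
  exact measurable_snd (MeasurableSet.of_discrete (s := {d : Fin D | waitTime d ≤ waitTime j}))

lemma measurable_cost : Measurable (cost j) :=
  (Measurable.of_discrete (f := fun d : Fin D => min (waitTime d) (waitTime j))).comp
    measurable_snd

end Draw

/-! ### Elapsed time and the number of epochs -/

section Path

variable {K D : ℕ} (x : ℕ → Fin K → Outcome D) (i : ℕ → Arm K D)

lemma elapsed_succ (n : ℕ) : elapsed x i (n + 1) = elapsed x i n + epochCost x i n :=
  Finset.sum_range_succ _ _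

lemma one_le_epochCost (n : ℕ) : 1 ≤ epochCost x i n := one_le_cost _ _

lemma elapsed_strictMono : StrictMono (elapsed x i) :=
  strictMono_nat_of_lt_succ fun n => by
    have := one_le_epochCost x i n
    rw [elapsed_succ]
    omega

lemma le_elapsed (n : ℕ) : n ≤ elapsed x i n := (elapsed_strictMono x i).le_apply

/-- Under this convention, whether epoch `s` is played is decided before its draw, which makes the
indicator a predictable weight. The other convention lacks this property, so the analysis is carried
out here and transferred. -/
lemma lt_numEpochs_untilExhausted_iff (T s : ℕ) :
    s < numEpochs x i T .untilExhausted ↔ elapsed x i s < T := by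
  have hne : {n | T ≤ elapsed x i n}.Nonempty := ⟨T, le_elapsed x i T⟩
  constructor
  · intro h
    by_contra hc
    exact Nat.notMem_of_lt_sInf h (not_lt.1 hc)
  · intro h
    by_contra hc
    have h1 : T ≤ elapsed x i (numEpochs x i T .untilExhausted) := Nat.sInf_mem hne
    have h2 := (elapsed_strictMono x i).monotone (not_lt.1 hc)
    omega

lemma bddAbove_elapsed_le (T : ℕ) : BddAbove {n | elapsed x i n ≤ T} :=
  ⟨T, fun n hn => (le_elapsed x i n).trans hn⟩

lemma lt_numEpochs_completedOnly_iff (T s : ℕ) :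
    s < numEpochs x i T .completedOnly ↔ elapsed x i (s + 1) ≤ T := by
  have hne : {n | elapsed x i n ≤ T}.Nonempty := ⟨0, by simp [elapsed]⟩
  constructor
  · intro h
    have h1 : elapsed x i (numEpochs x i T .completedOnly) ≤ T :=
      Nat.sSup_mem hne (bddAbove_elapsed_le x i T)
    exact ((elapsed_strictMono x i).monotone (Nat.succ_le_of_lt h)).trans h1
  · intro h
    exact Nat.lt_of_succ_le (le_csSup (bddAbove_elapsed_le x i T) h)

lemma numEpochs_le (T : ℕ) (rule : StopRule) : numEpochs x i T rule ≤ T := by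
  cases rule with
  | untilExhausted => exact Nat.sInf_le (le_elapsed x i T)
  | completedOnly =>
    by_contra h
    have h1 := (lt_numEpochs_completedOnly_iff x i T T).1 (not_le.1 h)
    have h2 := le_elapsed x i (T + 1)
    omega

lemma numEpochs_completedOnly_le (T : ℕ) :
    numEpochs x i T .completedOnly ≤ numEpochs x i T .untilExhausted := by
  by_contra h
  have h1 := (lt_numEpochs_completedOnly_iff x i T _).1 (not_le.1 h)
  have h2 := (lt_numEpochs_untilExhausted_iff x i T (numEpochs x i T .untilExhausted)).not.1
    (lt_irrefl _)
  have h3 := elapsed_strictMono x i (Nat.lt_succ_self (numEpochs x i T .untilExhausted))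
  simp only [Nat.succ_eq_add_one] at h3
  omega

lemma numEpochs_untilExhausted_le (T : ℕ) :
    numEpochs x i T .untilExhausted ≤ numEpochs x i T .completedOnly + 1 := by
  by_contra h
  have h1 := (lt_numEpochs_untilExhausted_iff x i T _).1 (not_le.1 h)
  have h2 := (lt_numEpochs_completedOnly_iff x i T (numEpochs x i T .completedOnly)).not.1
    (lt_irrefl _)
  omega

lemma epochReward_nonneg (s : ℕ) : 0 ≤ epochReward x i s := reward_nonneg _ _

lemma epochReward_le_one (s : ℕ) : epochReward x i s ≤ 1 := reward_le_one _ _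

lemma gameReward_le_untilExhausted (T : ℕ) (rule : StopRule) :
    gameReward x i T rule ≤ gameReward x i T .untilExhausted := by
  cases rule with
  | untilExhausted => exact le_rfl
  | completedOnly =>
    exact Finset.sum_le_sum_of_subset_of_nonneg
      (Finset.range_subset_range.2 (numEpochs_completedOnly_le x i T))
      fun s _ _ => epochReward_nonneg x i s

/-- The conventions differ by at most the epoch running at exhaustion, which is worth at most 1. -/
lemma gameReward_untilExhausted_le (T : ℕ) (rule : StopRule) :
    gameReward x i T .untilExhausted ≤ gameReward x i T rule + 1 := by
  cases rule with
  | untilExhausted => linarith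
  | completedOnly =>
    calc gameReward x i T .untilExhausted
        ≤ ∑ s ∈ Finset.range (numEpochs x i T .completedOnly + 1), epochReward x i s :=
          Finset.sum_le_sum_of_subset_of_nonneg
            (Finset.range_subset_range.2 (numEpochs_untilExhausted_le x i T))
            fun s _ _ => epochReward_nonneg x i s
      _ ≤ _ := by
          rw [Finset.sum_range_succ]
          exact add_le_add le_rfl (epochReward_le_one x i _)

lemma sum_range_numEpochs (T : ℕ) (rule : StopRule) (f : ℕ → ℝ) :
    ∑ s ∈ Finset.range (numEpochs x i T rule), f s =
      ∑ s ∈ Finset.range T, if s < numEpochs x i T rule then f s else 0 := by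
  rw [← Finset.sum_filter]
  congr 1
  ext s
  have := numEpochs_le x i T rule
  simp only [Finset.mem_range, Finset.mem_filter]
  omega

lemma gameReward_nonneg (T : ℕ) (rule : StopRule) : 0 ≤ gameReward x i T rule :=
  Finset.sum_nonneg fun s _ => epochReward_nonneg x i s

lemma gameReward_le (T : ℕ) (rule : StopRule) : gameReward x i T rule ≤ T := by
  calc gameReward x i T rule ≤ ∑ _s ∈ Finset.range (numEpochs x i T rule), (1 : ℝ) :=
        Finset.sum_le_sum fun s _ => epochReward_le_one x i s
    _ ≤ T := by simpa using numEpochs_le x i T rule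

lemma gameReward_untilExhausted_eq (T : ℕ) :
    gameReward x i T .untilExhausted =
      ∑ s ∈ Finset.range T, if elapsed x i s < T then epochReward x i s else 0 := by
  simp only [gameReward, sum_range_numEpochs, lt_numEpochs_untilExhausted_iff]

lemma gameReward_completedOnly_eq (T : ℕ) :
    gameReward x i T .completedOnly =
      ∑ s ∈ Finset.range T, if elapsed x i (s + 1) ≤ T then epochReward x i s else 0 := by
  simp only [gameReward, sum_range_numEpochs, lt_numEpochs_completedOnly_iff]

/-- The epochs before the budget is used up consume at least the budget. -/
lemma le_sum_epochCost (T : ℕ) :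
    (T : ℝ) ≤ ∑ s ∈ Finset.range T, if elapsed x i s < T then (epochCost x i s : ℝ) else 0 := by
  -- Truncating the elapsed time at `T` makes the claim inductive: once the budget is used up,
  -- neither side changes.
  have h : ∀ n, min (elapsed x i n) T ≤
      ∑ s ∈ Finset.range n, if elapsed x i s < T then epochCost x i s else 0 := by
    intro n
    induction n with
    | zero => simp [elapsed]
    | succ n ih =>
      rw [Finset.sum_range_succ, elapsed_succ]
      split_ifs <;> omega
  have h1 := h T
  rw [min_eq_right (le_elapsed x i T)] at h1
  exact_mod_cast h1

/-! ### Numbers of pulls -/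

variable (a : Arm K D)

lemma pulls_succ (n : ℕ) : pulls i a (n + 1) = pulls i a n + if i n = a then 1 else 0 := by
  unfold pulls
  rw [Finset.range_add_one, Finset.filter_insert]
  split_ifs <;> simp

lemma pulls_mono : Monotone (pulls i a) :=
  monotone_nat_of_le_succ fun n => by rw [pulls_succ]; omega

lemma pulls_le (n : ℕ) : pulls i a n ≤ n :=
  (Finset.card_filter_le _ _).trans (Finset.card_range n).le

/-- An arm pair is pulled at most `u + 1` times while it has been pulled at most `u` times. -/
lemma card_pulls_le (N : ℕ) (u : ℝ) (hu : 0 ≤ u) :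
    ((((Finset.range N).filter fun s => i s = a ∧ (pulls i a s : ℝ) ≤ u).card : ℕ) : ℝ)
      ≤ u + 1 := by
  have hc : ((Finset.range N).filter fun s => i s = a ∧ (pulls i a s : ℝ) ≤ u).card ≤
      (Finset.range (⌊u⌋₊ + 1)).card := by
    -- The pull counter increases strictly from one pull to the next, so it maps these epochs
    -- injectively into `{0, …, ⌊u⌋}`.
    refine Finset.card_le_card_of_injOn (pulls i a) ?_ ?_
    · intro s hs
      simp only [Finset.coe_filter, Finset.mem_range, Set.mem_ofPred_eq] at hs
      simp only [Finset.coe_range, Set.mem_Iio]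
      exact Nat.lt_succ_of_le (Nat.le_floor hs.2.2)
    · have key : ∀ s t, i s = a → s < t → pulls i a s < pulls i a t := by
        intro s t hs hst
        have h1 := pulls_succ i a s
        rw [if_pos hs] at h1
        have h2 := pulls_mono i a (Nat.succ_le_of_lt hst)
        simp only [Nat.succ_eq_add_one] at h2
        omega
      intro s hs t ht hst
      simp only [Finset.coe_filter, Finset.mem_range, Set.mem_ofPred_eq] at hs ht
      rcases lt_trichotomy s t with h | h | h
      · exact absurd hst (key s t hs.2.1 h).ne
      · exact h
      · exact absurd hst (key t s ht.2.1 h).ne'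
  rw [Finset.card_range] at hc
  calc _ ≤ ((⌊u⌋₊ + 1 : ℕ) : ℝ) := by exact_mod_cast hc
    _ ≤ u + 1 := by push_cast; linarith [Nat.floor_le hu]

end Path

/-! ### Elementary inequalities -/

lemma alpha_nonneg {D : ℕ} (j : Fin D) : 0 ≤ alpha j := by
  have : (1 : ℝ) ≤ waitTime j := by exact_mod_cast one_le_waitTime j
  unfold alpha
  linarith

lemma beta_pos {D : ℕ} (j : Fin D) : 0 < beta j := by
  unfold beta
  positivity

lemma beta_sq_le {D : ℕ} (j : Fin D) : beta j ^ 2 ≤ 4 * waitTime j := by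
  have h1 : (1 : ℝ) ≤ waitTime j := by exact_mod_cast one_le_waitTime j
  have h2 := Real.sq_sqrt (sub_nonneg.2 h1)
  unfold beta
  rw [mul_pow, Real.sq_sqrt (by norm_num)]
  nlinarith [sq_nonneg (√((waitTime j : ℝ) - 1) - 1)]

/-- Multiply the quadratic lower bound for `exp (-x)` by `1 + x + x²/2`: the product of the two
quadratics is `1 + x⁴/4 ≥ 1`. -/
lemma exp_le_quadratic_of_nonpos {x : ℝ} (hx : x ≤ 0) : Real.exp x ≤ 1 + x + x ^ 2 / 2 := by
  have h1 := Real.quadratic_le_exp_of_nonneg (neg_nonneg.2 hx)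
  have h2 : Real.exp x * Real.exp (-x) = 1 := by rw [← Real.exp_add]; simp
  have h3 : 0 < Real.exp x := Real.exp_pos x
  have h4 : 0 < 1 + -x + (-x) ^ 2 / 2 := by nlinarith
  have h5 : Real.exp x * (1 + -x + (-x) ^ 2 / 2) ≤ 1 := by
    exact (mul_le_mul_of_nonneg_left h1 h3.le).trans_eq h2
  have h6 : 1 ≤ (1 + x + x ^ 2 / 2) * (1 + -x + (-x) ^ 2 / 2) := by
    nlinarith [sq_nonneg (x ^ 2)]
  exact le_of_mul_le_mul_right (h5.trans h6) h4

lemma two_mul_three_pow_le_factorial (n : ℕ) : 2 * 3 ^ n ≤ (n + 2).factorial := by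
  induction n with
  | zero => simp
  | succ n ih =>
    have h : (n + 1 + 2).factorial = (n + 3) * (n + 2).factorial := Nat.factorial_succ (n + 2)
    rw [h, pow_succ]
    nlinarith

/-- The inequality behind the moment generating function bound of Bernstein's inequality. -/
lemma exp_le_bernstein {x y : ℝ} (hxy : x ≤ y) (hy : 0 ≤ y) (hy3 : y < 3) :
    Real.exp x ≤ 1 + x + x ^ 2 / (2 * (1 - y / 3)) := by
  have hd : 0 < 1 - y / 3 := by linarith
  rcases le_total x 0 with hx | hx
  · refine (exp_le_quadratic_of_nonpos hx).trans ?_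
    gcongr
    linarith
  -- For `x ≥ 0` the Taylor tail from the quadratic term on is dominated by a geometric series,
  -- since `(n + 2)! ≥ 2 · 3ⁿ`.
  · have h1 : HasSum (fun n : ℕ => x ^ (n + 2) / (n + 2).factorial)
        (Real.exp x - ∑ n ∈ Finset.range 2, x ^ n / n.factorial) := by
      refine (hasSum_nat_add_iff' 2).2 ?_
      rw [Real.exp_eq_exp_ℝ]
      exact NormedSpace.expSeries_div_hasSum_exp x
    have h2 : HasSum (fun n : ℕ => x ^ 2 / 2 * (y / 3) ^ n) (x ^ 2 / 2 * (1 - y / 3)⁻¹) :=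
      (hasSum_geometric_of_lt_one (by positivity) (by linarith)).mul_left _
    have h3 : ∀ n : ℕ, x ^ (n + 2) / (n + 2).factorial ≤ x ^ 2 / 2 * (y / 3) ^ n := by
      intro n
      have hf : (2 * 3 ^ n : ℝ) ≤ (n + 2).factorial := by
        exact_mod_cast two_mul_three_pow_le_factorial n
      calc x ^ (n + 2) / (n + 2).factorial ≤ x ^ (n + 2) / (2 * 3 ^ n) := by gcongr
        _ = x ^ 2 / 2 * (x / 3) ^ n := by rw [div_pow, pow_add]; field_simp
        _ ≤ _ := by gcongr
    have h4 := hasSum_le h3 h1 h2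
    simp only [Finset.sum_range_succ, Finset.sum_range_zero] at h4
    have h5 : x ^ 2 / 2 * (1 - y / 3)⁻¹ = x ^ 2 / (2 * (1 - y / 3)) := by
      field_simp
    norm_num at h4
    rw [← h5]
    linarith

lemma integrable_of_bounded {α : Type*} [MeasurableSpace α] {μ : Measure α} [IsFiniteMeasure μ]
    {f : α → ℝ} (hf : Measurable f) (B : ℝ) (hB : ∀ x, |f x| ≤ B) : Integrable f μ :=
  Integrable.of_bound hf.aestronglyMeasurable B (Filter.Eventually.of_forall hB)

section Draw

variable {D : ℕ} (j : Fin D)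

lemma measurable_cost_real : Measurable fun z : Outcome D => (cost j z : ℝ) :=
  (Measurable.of_discrete (f := fun n : ℕ => (n : ℝ))).comp (measurable_cost j)

lemma integrable_reward (q : Measure (Outcome D)) [IsFiniteMeasure q] :
    Integrable (reward j) q :=
  integrable_of_bounded (measurable_reward j) 1 fun z =>
    abs_le.2 ⟨by linarith [reward_nonneg j z], reward_le_one j z⟩

lemma integrable_cost (q : Measure (Outcome D)) [IsFiniteMeasure q] :
    Integrable (fun z => (cost j z : ℝ)) q :=
  integrable_of_bounded (measurable_cost_real j) (waitTime j) fun z =>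
    abs_le.2 ⟨by linarith [one_le_cost_real j z, cost_le_real j z], cost_le_real j z⟩

end Draw

/-! ### Mean values -/

section Means

variable {K D : ℕ} (Q : Fin K → Measure (Outcome D)) (a : Arm K D)

lemma meanReward_nonneg : 0 ≤ meanReward Q a := integral_nonneg fun z => reward_nonneg _ z

lemma ratio_le_iSup : ratio Q a ≤ ⨆ b : Arm K D, ratio Q b :=
  le_ciSup (Set.finite_range _).bddAbove a

lemma gap_nonneg : 0 ≤ gap Q a := sub_nonneg.2 (ratio_le_iSup Q a)

lemma mem_subopt : a ∈ subopt Q ↔ 0 < gap Q a := by simp [subopt]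

/-- The centred difference between the reward and the consumed time weighted by the ratio. -/
noncomputable def noise (z : Outcome D) : ℝ := reward a.2 z - ratio Q a * cost a.2 z

lemma measurable_noise : Measurable (noise Q a) :=
  (measurable_reward _).sub ((measurable_cost_real _).const_mul _)

variable [∀ k, IsProbabilityMeasure (Q k)]

lemma meanReward_le_one : meanReward Q a ≤ 1 := by
  have h := integral_mono (μ := Q a.1) (integrable_reward a.2 _) (integrable_const (1 : ℝ))
    fun z => reward_le_one a.2 z
  simpa [meanReward] using h

lemma one_le_meanWait : 1 ≤ meanWait Q a := by
  have h := integral_mono (μ := Q a.1) (integrable_const (1 : ℝ)) (integrable_cost a.2 _)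
    fun z => one_le_cost_real a.2 z
  simpa [meanWait] using h

lemma meanWait_le : meanWait Q a ≤ waitTime a.2 := by
  have h := integral_mono (μ := Q a.1) (integrable_cost a.2 _)
    (integrable_const (waitTime a.2 : ℝ)) fun z => cost_le_real a.2 z
  simpa [meanWait] using h

lemma ratio_mul_meanWait : ratio Q a * meanWait Q a = meanReward Q a :=
  div_mul_cancel₀ _ (by linarith [one_le_meanWait Q a])

lemma ratio_nonneg : 0 ≤ ratio Q a :=
  div_nonneg (meanReward_nonneg Q a) (by linarith [one_le_meanWait Q a])

lemma ratio_le_one : ratio Q a ≤ 1 :=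
  div_le_one_of_le₀ ((meanReward_le_one Q a).trans (one_le_meanWait Q a))
    (by linarith [one_le_meanWait Q a])

lemma gap_le_one : gap Q a ≤ 1 := by
  have : Nonempty (Arm K D) := ⟨a⟩
  have h : (⨆ b : Arm K D, ratio Q b) ≤ 1 := ciSup_le fun b => ratio_le_one Q b
  have h1 := ratio_nonneg Q a
  unfold gap
  linarith

lemma noise_le_one (z : Outcome D) : noise Q a z ≤ 1 := by
  have h1 := reward_le_one a.2 z
  have h2 := mul_nonneg (ratio_nonneg Q a) (zero_le_one.trans (one_le_cost_real a.2 z))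
  unfold noise
  linarith

lemma neg_noise_le (z : Outcome D) : -noise Q a z ≤ waitTime a.2 := by
  have h1 := reward_nonneg a.2 z
  have h2 : ratio Q a * cost a.2 z ≤ 1 * waitTime a.2 :=
    mul_le_mul (ratio_le_one Q a) (cost_le_real a.2 z) (by positivity) zero_le_one
  unfold noise
  linarith

lemma abs_noise_le (z : Outcome D) : |noise Q a z| ≤ waitTime a.2 := by
  have h : (1 : ℝ) ≤ waitTime a.2 := by exact_mod_cast one_le_waitTime a.2
  exact abs_le.2 ⟨by linarith [neg_noise_le Q a z], (noise_le_one Q a z).trans h⟩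

lemma integrable_noise : Integrable (noise Q a) (Q a.1) :=
  integrable_of_bounded (measurable_noise Q a) _ (abs_noise_le Q a)

lemma integral_noise : ∫ z, noise Q a z ∂(Q a.1) = 0 := by
  unfold noise
  rw [integral_sub (integrable_reward _ _) ((integrable_cost _ _).const_mul _),
    integral_const_mul]
  have := ratio_mul_meanWait Q a
  unfold meanWait meanReward at this
  linarith

lemma integral_sq_reward_sub_le :
    ∫ z, (reward a.2 z - meanReward Q a) ^ 2 ∂(Q a.1) ≤ 1 / 4 := by
  have h1 : ∫ z, (reward a.2 z - meanReward Q a) ^ 2 ∂(Q a.1) ≤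
      ∫ z, ((1 - 2 * meanReward Q a) * reward a.2 z + meanReward Q a ^ 2) ∂(Q a.1) := by
    refine integral_mono ?_ (((integrable_reward _ _).const_mul _).add (integrable_const _)) ?_
    · refine integrable_of_bounded (((measurable_reward _).sub_const _).pow_const 2) 1 fun z => ?_
      have h1 := reward_nonneg a.2 z
      have h2 := reward_le_one a.2 z
      have h3 := meanReward_nonneg Q a
      have h4 := meanReward_le_one Q a
      rw [abs_of_nonneg (sq_nonneg _)]
      nlinarith
    · intro z
      have h1 := reward_nonneg a.2 z
      have h2 := reward_le_one a.2 z
      dsimp only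
      nlinarith
  rw [integral_add ((integrable_reward _ _).const_mul _) (integrable_const _),
    integral_const_mul] at h1
  have h2 : ∫ z, reward a.2 z ∂(Q a.1) = meanReward Q a := rfl
  rw [h2] at h1
  simp only [integral_const, probReal_univ, one_smul] at h1
  nlinarith [sq_nonneg (meanReward Q a - 1 / 2)]

/-- Integrate `(c - 1)(c - j) ≤ 0`. The factor `μ - 1` is kept because it is compensated later by
`γ² ≤ μ⁻²`. -/
lemma integral_sq_cost_sub_le :
    ∫ z, ((cost a.2 z : ℝ) - meanWait Q a) ^ 2 ∂(Q a.1) ≤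
      ((waitTime a.2 : ℝ) - 1) * (meanWait Q a - 1) := by
  have h1 : ∫ z, ((cost a.2 z : ℝ) - meanWait Q a) ^ 2 ∂(Q a.1) ≤
      ∫ z, (((waitTime a.2 : ℝ) + 1 - 2 * meanWait Q a) * cost a.2 z +
        (meanWait Q a ^ 2 - waitTime a.2)) ∂(Q a.1) := by
    refine integral_mono ?_ (((integrable_cost _ _).const_mul _).add (integrable_const _)) ?_
    · refine integrable_of_bounded (((measurable_cost_real _).sub_const _).pow_const 2)
        ((waitTime a.2 : ℝ) ^ 2) fun z => ?_
      have h1 := one_le_cost_real a.2 z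
      have h2 := cost_le_real a.2 z
      have h3 := one_le_meanWait Q a
      have h4 := meanWait_le Q a
      rw [abs_of_nonneg (sq_nonneg _)]
      exact sq_le_sq' (by linarith) (by linarith)
    · intro z
      have h1 := one_le_cost_real a.2 z
      have h2 := cost_le_real a.2 z
      dsimp only
      nlinarith
  rw [integral_add ((integrable_cost _ _).const_mul _) (integrable_const _),
    integral_const_mul] at h1
  have h2 : ∫ z, (cost a.2 z : ℝ) ∂(Q a.1) = meanWait Q a := rfl
  rw [h2] at h1
  simp only [integral_const, probReal_univ, one_smul] at h1
  nlinarith [sq_nonneg (meanWait Q a - 1)]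

lemma integral_sq_noise_le (hj : 2 ≤ waitTime a.2) :
    ∫ z, noise Q a z ^ 2 ∂(Q a.1) ≤ beta a.2 ^ 2 / 8 := by
  have hj' : (2 : ℝ) ≤ waitTime a.2 := by exact_mod_cast hj
  set w := √((waitTime a.2 : ℝ) - 1) with hw
  have hw0 : 0 < w := Real.sqrt_pos.2 (by linarith)
  have hw2 : w ^ 2 = (waitTime a.2 : ℝ) - 1 := Real.sq_sqrt (by linarith)
  have hmr := ratio_mul_meanWait Q a
  have hm1 := one_le_meanWait Q a
  have hint1 : Integrable (fun z => (reward a.2 z - meanReward Q a) ^ 2) (Q a.1) := by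
    refine integrable_of_bounded (((measurable_reward _).sub_const _).pow_const 2) 1 fun z => ?_
    have h1 := reward_nonneg a.2 z
    have h2 := reward_le_one a.2 z
    have h3 := meanReward_nonneg Q a
    have h4 := meanReward_le_one Q a
    rw [abs_of_nonneg (sq_nonneg _)]
    nlinarith
  have hint2 : Integrable (fun z => ((cost a.2 z : ℝ) - meanWait Q a) ^ 2) (Q a.1) := by
    refine integrable_of_bounded (((measurable_cost_real _).sub_const _).pow_const 2)
        ((waitTime a.2 : ℝ) ^ 2) fun z => ?_
    have h1 := one_le_cost_real a.2 z
    have h2 := cost_le_real a.2 z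
    have h4 := meanWait_le Q a
    rw [abs_of_nonneg (sq_nonneg _)]
    exact sq_le_sq' (by linarith) (by linarith)
  -- Young's inequality with weight `w = √(j - 1)`, the quotient of the standard deviation bounds
  -- `w/2` for `γ c` and `1/2` for the reward. This weight gives `(1 + w)²/4 = β²/8`.
  have hpt : ∀ z, noise Q a z ^ 2 ≤ (1 + w) * (reward a.2 z - meanReward Q a) ^ 2 +
      (1 + w⁻¹) * ratio Q a ^ 2 * ((cost a.2 z : ℝ) - meanWait Q a) ^ 2 := by
    intro z
    have h : noise Q a z = (reward a.2 z - meanReward Q a) -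
        ratio Q a * ((cost a.2 z : ℝ) - meanWait Q a) := by
      unfold noise
      rw [← hmr]
      ring
    rw [h]
    set A := reward a.2 z - meanReward Q a
    set B := ratio Q a * ((cost a.2 z : ℝ) - meanWait Q a) with hB
    have h2 : (1 + w⁻¹) * ratio Q a ^ 2 * ((cost a.2 z : ℝ) - meanWait Q a) ^ 2 =
        (1 + w⁻¹) * B ^ 2 := by rw [hB]; ring
    rw [h2]
    have h3 : (1 + w) * A ^ 2 + (1 + w⁻¹) * B ^ 2 - (A - B) ^ 2 = w⁻¹ * (w * A + B) ^ 2 := by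
      field_simp
      ring
    have h4 : 0 ≤ w⁻¹ * (w * A + B) ^ 2 := by positivity
    linarith
  have hI := integral_mono (μ := Q a.1)
    (integrable_of_bounded ((measurable_noise Q a).pow_const 2) ((waitTime a.2 : ℝ) ^ 2)
      fun z => by
        rw [abs_of_nonneg (sq_nonneg _), ← sq_abs]
        exact pow_le_pow_left₀ (abs_nonneg _) (abs_noise_le Q a z) 2)
    ((hint1.const_mul _).add (hint2.const_mul _)) hpt
  refine hI.trans ?_
  simp only [Pi.add_apply]
  rw [integral_add (hint1.const_mul _) (hint2.const_mul _), integral_const_mul,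
    integral_const_mul]
  have h1 := integral_sq_reward_sub_le Q a
  have h2 := integral_sq_cost_sub_le Q a
  -- From `γ μ ≤ 1` and `μ - 1 ≤ μ²/4`.
  have hg : ratio Q a ^ 2 * (meanWait Q a - 1) ≤ 1 / 4 := by
    have h3 : ratio Q a ^ 2 * meanWait Q a ^ 2 ≤ 1 := by
      rw [← mul_pow, hmr]
      exact pow_le_one₀ (meanReward_nonneg Q a) (meanReward_le_one Q a)
    nlinarith [mul_nonneg (sq_nonneg (ratio Q a)) (sq_nonneg (meanWait Q a - 2))]
  have h5 : ratio Q a ^ 2 * ∫ z, ((cost a.2 z : ℝ) - meanWait Q a) ^ 2 ∂(Q a.1) ≤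
      w ^ 2 / 4 := by
    calc _ ≤ ratio Q a ^ 2 * (((waitTime a.2 : ℝ) - 1) * (meanWait Q a - 1)) := by gcongr
      _ = w ^ 2 * (ratio Q a ^ 2 * (meanWait Q a - 1)) := by rw [hw2]; ring
      _ ≤ w ^ 2 * (1 / 4) := by gcongr
      _ = _ := by ring
  have hb : beta a.2 ^ 2 / 8 = (1 + w) ^ 2 / 4 := by
    unfold beta
    rw [← hw, mul_pow, Real.sq_sqrt (by norm_num)]
    ring
  rw [hb, mul_assoc]
  calc _ ≤ (1 + w) * (1 / 4) + (1 + w⁻¹) * (w ^ 2 / 4) := by gcongr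
    _ = _ := by field_simp; ring

/-- Bound on the moment generating function of the noise and of its negative. -/
lemma integral_exp_noise_le {σ : ℝ} (hσ : σ = 1 ∨ σ = -1) {l : ℝ} (hl : 0 ≤ l)
    (hal : alpha a.2 * l < 4) :
    ∫ z, Real.exp (l * (σ * noise Q a z)) ∂(Q a.1) ≤
      Real.exp (beta a.2 ^ 2 / 8 * l ^ 2 / (2 * (1 - alpha a.2 * l / 4))) := by
  have hσ2 : σ ^ 2 = 1 := by rcases hσ with rfl | rfl <;> norm_num
  -- For waiting time 1, `α = 0` and the noise is the centred reward, so Hoeffding's lemma on `[0,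
  -- 1]` gives the bound without a scale term. Longer waits use Bernstein's inequality.
  rcases (one_le_waitTime a.2).eq_or_lt' with hj | hj
  · have hc : ∀ z, cost a.2 z = 1 := fun z =>
      le_antisymm ((cost_le _ _).trans hj.le) (one_le_cost _ _)
    have hw : meanWait Q a = 1 := by simp [meanWait, hc]
    have hn : ∀ z, noise Q a z = reward a.2 z - (∫ z, reward a.2 z ∂(Q a.1)) := by
      intro z
      have := ratio_mul_meanWait Q a
      rw [hw, mul_one] at this
      simp [noise, hc, this, meanReward]
    have hs := (hasSubgaussianMGF_of_mem_Icc (μ := Q a.1) (a := 0) (b := 1)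
      (measurable_reward a.2).aemeasurable
      (Filter.Eventually.of_forall fun z => ⟨reward_nonneg a.2 z, reward_le_one a.2 z⟩)).mgf_le
        (l * σ)
    have ha : alpha a.2 = 0 := by simp [alpha, hj]
    have hb : beta a.2 ^ 2 = 2 := by simp [beta, hj]
    rw [ha, hb]
    simp only [mgf] at hs
    calc _ = _ := by
          congr 1
          ext z
          rw [hn z, mul_assoc]
      _ ≤ _ := hs
      _ = _ := by
          congr 1
          simp
          rw [mul_pow, hσ2]
          ring
  · have hj' : (2 : ℝ) ≤ waitTime a.2 := by exact_mod_cast hj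
    have hα : alpha a.2 = 4 / 3 * (2 * ((waitTime a.2 : ℝ) - 1)) := by unfold alpha; ring
    have hd : 0 < 1 - alpha a.2 * l / 4 := by linarith
    -- The noise is at most `j` in absolute value, and `j ≤ 2 (j - 1)` for `j ≥ 2`; this is where
    -- the form of `α` comes from.
    have hY : ∀ z, σ * noise Q a z ≤ 2 * ((waitTime a.2 : ℝ) - 1) := by
      intro z
      have h1 := noise_le_one Q a z
      have h2 := neg_noise_le Q a z
      rcases hσ with rfl | rfl <;> linarith
    have hpt : ∀ z, Real.exp (l * (σ * noise Q a z)) ≤ 1 + l * σ * noise Q a z +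
        l ^ 2 / (2 * (1 - alpha a.2 * l / 4)) * noise Q a z ^ 2 := by
      intro z
      have h := exp_le_bernstein (x := l * (σ * noise Q a z))
        (y := l * (2 * ((waitTime a.2 : ℝ) - 1))) (mul_le_mul_of_nonneg_left (hY z) hl)
        (mul_nonneg hl (by linarith)) (by rw [hα] at hal; linarith)
      have e1 : l * (2 * ((waitTime a.2 : ℝ) - 1)) / 3 = alpha a.2 * l / 4 := by
        rw [hα]; ring
      have e2 : (l * (σ * noise Q a z)) ^ 2 = l ^ 2 * noise Q a z ^ 2 := by
        rw [mul_pow, mul_pow, hσ2, one_mul]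
      rw [e1, e2] at h
      refine h.trans_eq ?_
      ring
    have hi2 : Integrable (fun z => noise Q a z ^ 2) (Q a.1) :=
      integrable_of_bounded ((measurable_noise Q a).pow_const 2) ((waitTime a.2 : ℝ) ^ 2)
      fun z => by
        rw [abs_of_nonneg (sq_nonneg _), ← sq_abs]
        exact pow_le_pow_left₀ (abs_nonneg _) (abs_noise_le Q a z) 2
    have hi3 : Integrable (fun z => Real.exp (l * (σ * noise Q a z))) (Q a.1) := by
      refine integrable_of_bounded
        (((measurable_noise Q a).const_mul σ).const_mul l).exp
        (Real.exp (l * (2 * ((waitTime a.2 : ℝ) - 1)))) fun z => ?_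
      rw [abs_of_pos (Real.exp_pos _)]
      exact Real.exp_le_exp.2 (mul_le_mul_of_nonneg_left (hY z) hl)
    have hi1 := (integrable_noise Q a).const_mul (l * σ)
    have hi4 : Integrable (fun z => 1 + l * σ * noise Q a z) (Q a.1) :=
      (integrable_const (1 : ℝ)).add hi1
    have hI := integral_mono hi3 (hi4.add
      (hi2.const_mul (l ^ 2 / (2 * (1 - alpha a.2 * l / 4))))) hpt
    refine hI.trans ?_
    simp only [Pi.add_apply]
    rw [integral_add hi4 (hi2.const_mul _),
      integral_add (integrable_const (1 : ℝ)) hi1, integral_const_mul, integral_const_mul,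
      integral_noise]
    have h1 := integral_sq_noise_le Q a hj
    simp only [integral_const, probReal_univ, one_smul, mul_zero, add_zero]
    have h2 : l ^ 2 / (2 * (1 - alpha a.2 * l / 4)) * ∫ z, noise Q a z ^ 2 ∂(Q a.1) ≤
        beta a.2 ^ 2 / 8 * l ^ 2 / (2 * (1 - alpha a.2 * l / 4)) := by
      calc _ ≤ l ^ 2 / (2 * (1 - alpha a.2 * l / 4)) * (beta a.2 ^ 2 / 8) := by gcongr
        _ = _ := by ring
    have h3 := Real.add_one_le_exp (beta a.2 ^ 2 / 8 * l ^ 2 / (2 * (1 - alpha a.2 * l / 4)))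
    linarith

end Means

/-- The exponent that makes Chernoff's bound yield the deviation `α ℓ + β √(ℓ n)` with error
probability `exp (-4 ℓ)`. -/
lemma exists_chernoff_exponent {α β ℓ : ℝ} {n : ℕ} (hα : 0 ≤ α) (hβ : 0 < β) (hℓ : 0 ≤ ℓ)
    (hn : 0 < n) :
    ∃ l : ℝ, 0 ≤ l ∧ α * l < 4 ∧
      n * (β ^ 2 / 8 * l ^ 2 / (2 * (1 - α * l / 4))) - l * (α * ℓ + β * √(ℓ * n)) = -(4 * ℓ) := by
  have hn' : (0 : ℝ) < n := by exact_mod_cast hn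
  set r := √(ℓ * n) with hr
  have hr2 : r ^ 2 = ℓ * n := Real.sq_sqrt (by positivity)
  have hr0 : 0 ≤ r := Real.sqrt_nonneg _
  have hu : 0 ≤ 8 * r / (β * n) := by positivity
  set u := 8 * r / (β * n) with hudef
  have hun : u * β * n = 8 * r := by rw [hudef]; field_simp
  have hd : 0 < 1 + α / 4 * u := by positivity
  have hd' : 1 - α * (u / (1 + α / 4 * u)) / 4 = 1 / (1 + α / 4 * u) := by
    field_simp
    ring
  -- The sub-gamma choice `l = u / (1 + c u)` with `u = √(2t/v)`, for variance `v = n β²/8`, scale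
  -- `c = α/4` and target exponent `t = 4ℓ`; the deviation is then `√(2vt) + c t`.
  refine ⟨u / (1 + α / 4 * u), by positivity, ?_, ?_⟩
  · have h : 0 < 1 - α * (u / (1 + α / 4 * u)) / 4 := by rw [hd']; positivity
    linarith
  · rw [hd']
    have h1 : n * (β ^ 2 / 8 * (u / (1 + α / 4 * u)) ^ 2 / (2 * (1 / (1 + α / 4 * u)))) =
        n * β ^ 2 * u ^ 2 / 16 / (1 + α / 4 * u) := by
      field_simp
      ring
    have h2 : n * β ^ 2 * u ^ 2 / 16 = 4 * ℓ := by
      have : n * (n * β ^ 2 * u ^ 2 / 16) = n * (4 * ℓ) := by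
        calc n * (n * β ^ 2 * u ^ 2 / 16) = (u * β * n) ^ 2 / 16 := by ring
          _ = 4 * r ^ 2 := by rw [hun]; ring
          _ = _ := by rw [hr2]; ring
      exact mul_left_cancel₀ hn'.ne' this
    have h3 : u * β * r = 8 * ℓ := by
      have : n * (u * β * r) = n * (8 * ℓ) := by
        calc n * (u * β * r) = (u * β * n) * r := by ring
          _ = 8 * r ^ 2 := by rw [hun]; ring
          _ = _ := by rw [hr2]; ring
      exact mul_left_cancel₀ hn'.ne' this
    rw [h1, h2]
    have h4 : u / (1 + α / 4 * u) * (α * ℓ + β * r) =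
        (u * α * ℓ + 8 * ℓ) / (1 + α / 4 * u) := by
      rw [← h3]
      ring
    rw [h4]
    field_simp
    ring

/-! ### Accumulated noise and pulls within the budget -/

section Path

variable {K D : ℕ} (Q : Fin K → Measure (Outcome D)) (x : ℕ → Fin K → Outcome D) (i : ℕ → Arm K D)
  (a : Arm K D)

/-- Sum of the noise in the first `n` epochs over the pulls of `a`. -/
noncomputable def noiseSum (n : ℕ) : ℝ :=
  ∑ s ∈ Finset.range n, if i s = a then noise Q a (x s (i s).1) else 0

lemma noiseSum_succ (n : ℕ) : noiseSum Q x i a (n + 1) =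
    noiseSum Q x i a n + if i n = a then noise Q a (x n (i n).1) else 0 :=
  Finset.sum_range_succ _ _

/-- After `n` epochs, the noise of `a` with sign `σ` exceeds the deviation allowed by Wait-UCB. -/
def Deviates (σ : ℝ) (n : ℕ) : Prop :=
  1 ≤ pulls i a n ∧
    alpha a.2 * Real.log n + beta a.2 * √(Real.log n * pulls i a n) ≤ σ * noiseSum Q x i a n

/-- Number of pulls of `a` before the budget is used up. -/
noncomputable def gamePulls (T : ℕ) : ℝ :=
  ∑ s ∈ Finset.range T, if elapsed x i s < T ∧ i s = a then 1 else 0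

end Path

/-! ### Measurability and independence from the past -/

section Measurability

variable {K D : ℕ} {Ω : Type*}

lemma measurable_comp_of_fintype {β γ δ : Type*} [MeasurableSpace Ω] [Fintype β]
    [MeasurableSpace β] [MeasurableSingletonClass β] [MeasurableSpace γ] [MeasurableSpace δ]
    {W : Ω → β} (hW : Measurable W) {Y : β → Ω → γ} (hY : ∀ b, Measurable (Y b))
    {g : β → γ → δ} (hg : ∀ b, Measurable (g b)) : Measurable fun ω => g (W ω) (Y (W ω) ω) := by
  intro S hS
  have h : (fun ω => g (W ω) (Y (W ω) ω)) ⁻¹' S =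
      ⋃ b, (W ⁻¹' {b} ∩ (fun ω => g b (Y b ω)) ⁻¹' S) := by
    ext ω
    simp
  rw [h]
  exact MeasurableSet.iUnion fun b =>
    (hW (measurableSet_singleton b)).inter (((hg b).comp (hY b)) hS)

variable [m : MeasurableSpace Ω] {P : Measure Ω} {ℱ : Filtration ℕ m}
  {Q : Fin K → Measure (Outcome D)} {X : ℕ → Fin K → Ω → Outcome D} {i : ℕ → Ω → Arm K D}

lemma measurable_epoch {δ : Type*} [MeasurableSpace δ] (hE : IsEnvironment P ℱ Q X)
    (hi : ∀ s, Measurable[ℱ s] (i s)) {g : Arm K D → Outcome D → δ}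
    (hg : ∀ b, Measurable (g b)) {s n : ℕ} (hs : s < n) :
    Measurable[ℱ n] fun ω => g (i s ω) (X s (i s ω).1 ω) := by
  have h1 : Measurable[ℱ n] (i s) := (hi s).mono (ℱ.mono hs.le) le_rfl
  have h2 : ∀ b : Arm K D, Measurable[ℱ n] (X s b.1) := fun b =>
    (hE.adapted s b.1).mono (ℱ.mono hs) le_rfl
  exact @measurable_comp_of_fintype Ω _ _ _ (ℱ n) _ _ _ _ _ (i s) h1 (fun b => X s b.1) h2 g hg

lemma measurable_elapsed (hE : IsEnvironment P ℱ Q X) (hi : ∀ s, Measurable[ℱ s] (i s)) (n : ℕ) :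
    Measurable[ℱ n] fun ω => elapsed (fun s k => X s k ω) (fun s => i s ω) n := by
  unfold elapsed epochCost
  refine Finset.measurable_fun_sum _ fun s hs => ?_
  exact measurable_epoch hE hi (g := fun b z => cost b.2 z) (fun b => measurable_cost _)
    (Finset.mem_range.1 hs)

lemma measurable_pulls (hi : ∀ s, Measurable[ℱ s] (i s)) (a : Arm K D) (n : ℕ) :
    Measurable[ℱ n] fun ω => pulls (fun s => i s ω) a n := by
  unfold pulls
  simp only [Finset.card_filter]
  refine Finset.measurable_fun_sum _ fun s hs => ?_
  have h1 : Measurable[ℱ n] (i s) := (hi s).mono (ℱ.mono (Finset.mem_range.1 hs).le) le_rfl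
  exact Measurable.ite (h1 (measurableSet_singleton a)) measurable_const measurable_const

lemma measurable_noiseSum (hE : IsEnvironment P ℱ Q X) (hi : ∀ s, Measurable[ℱ s] (i s))
    (a : Arm K D) (n : ℕ) :
    Measurable[ℱ n] fun ω => noiseSum Q (fun s k => X s k ω) (fun s => i s ω) a n := by
  unfold noiseSum
  refine Finset.measurable_fun_sum _ fun s hs => ?_
  refine measurable_epoch hE hi (g := fun b z => if b = a then noise Q a z else 0) (fun b => ?_)
    (Finset.mem_range.1 hs)
  split_ifs
  · exact measurable_noise Q a
  · exact measurable_const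

lemma measurable_gameReward (hE : IsEnvironment P ℱ Q X) (hi : ∀ s, Measurable[ℱ s] (i s))
    (T : ℕ) (rule : StopRule) :
    Measurable fun ω => gameReward (fun s k => X s k ω) (fun s => i s ω) T rule := by
  have he : ∀ n, Measurable fun ω => elapsed (fun s k => X s k ω) (fun s => i s ω) n := fun n =>
    (measurable_elapsed hE hi n).mono (ℱ.le n) le_rfl
  have hr : ∀ s, Measurable fun ω => epochReward (fun s k => X s k ω) (fun s => i s ω) s :=
    fun s => (measurable_epoch hE hi (g := fun b z => reward b.2 z)
      (fun b => measurable_reward _) (Nat.lt_succ_self s)).mono (ℱ.le _) le_rfl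
  cases rule with
  | untilExhausted =>
    simp only [gameReward_untilExhausted_eq]
    refine Finset.measurable_fun_sum _ fun s _ => ?_
    exact Measurable.ite (measurableSet_lt (he s) measurable_const) (hr s) measurable_const
  | completedOnly =>
    simp only [gameReward_completedOnly_eq]
    refine Finset.measurable_fun_sum _ fun s _ => ?_
    exact Measurable.ite (measurableSet_le (he _) measurable_const) (hr s) measurable_const

lemma integrable_gameReward [IsFiniteMeasure P] (hE : IsEnvironment P ℱ Q X)
    (hi : ∀ s, Measurable[ℱ s] (i s)) (T : ℕ) (rule : StopRule) :
    Integrable (fun ω => gameReward (fun s k => X s k ω) (fun s => i s ω) T rule) P :=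
  integrable_of_bounded (measurable_gameReward hE hi T rule) T fun ω => by
    rw [abs_of_nonneg (gameReward_nonneg _ _ _ _)]
    exact gameReward_le _ _ _ _

lemma measurableSet_deviates (hE : IsEnvironment P ℱ Q X) (hi : ∀ s, Measurable[ℱ s] (i s))
    (a : Arm K D) (σ : ℝ) (n : ℕ) :
    MeasurableSet {ω | Deviates Q (fun s k => X s k ω) (fun s => i s ω) a σ n} := by
  have h1 : Measurable fun ω => pulls (fun s => i s ω) a n :=
    (measurable_pulls hi a n).mono (ℱ.le n) le_rfl
  have h2 : Measurable fun ω => noiseSum Q (fun s k => X s k ω) (fun s => i s ω) a n :=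
    (measurable_noiseSum hE hi a n).mono (ℱ.le n) le_rfl
  have h3 : Measurable fun ω => (pulls (fun s => i s ω) a n : ℝ) :=
    (Measurable.of_discrete (f := fun n : ℕ => (n : ℝ))).comp h1
  unfold Deviates
  exact (measurableSet_le measurable_const h1).inter
    (measurableSet_le (((h3.const_mul _).sqrt.const_mul _).const_add _) (h2.const_mul σ))

lemma measurable_gamePulls (hE : IsEnvironment P ℱ Q X) (hi : ∀ s, Measurable[ℱ s] (i s))
    (a : Arm K D) (T : ℕ) :
    Measurable fun ω => gamePulls (fun s k => X s k ω) (fun s => i s ω) a T := by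
  unfold gamePulls
  refine Finset.measurable_fun_sum _ fun s _ => ?_
  refine Measurable.ite (MeasurableSet.inter ?_ ?_) measurable_const measurable_const
  · exact measurableSet_lt ((measurable_elapsed hE hi s).mono (ℱ.le s) le_rfl) measurable_const
  · exact (hi s).mono (ℱ.le s) le_rfl (measurableSet_singleton a)

lemma integrable_gamePulls [IsFiniteMeasure P] (hE : IsEnvironment P ℱ Q X)
    (hi : ∀ s, Measurable[ℱ s] (i s)) (a : Arm K D) (T : ℕ) :
    Integrable (fun ω => gamePulls (fun s k => X s k ω) (fun s => i s ω) a T) P := by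
  refine integrable_of_bounded (measurable_gamePulls hE hi a T) T fun ω => ?_
  have h : ∀ s ∈ Finset.range T, (0 : ℝ) ≤
      if elapsed (fun s k => X s k ω) (fun s => i s ω) s < T ∧ i s ω = a then 1 else 0 := by
    intro s _
    split_ifs <;> norm_num
  rw [gamePulls, abs_of_nonneg (Finset.sum_nonneg h)]
  calc _ ≤ ∑ _s ∈ Finset.range T, (1 : ℝ) := by
        refine Finset.sum_le_sum fun s _ => ?_
        split_ifs <;> norm_num
    _ = T := by simp

/-- A draw is independent of the past. -/
lemma integral_mul_draw (hE : IsEnvironment P ℱ Q X) (s : ℕ) (k : Fin K) {Z : Ω → ℝ}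
    (hZ : Measurable[ℱ s] Z) {g : Outcome D → ℝ} (hg : Measurable g) :
    ∫ ω, Z ω * g (X s k ω) ∂P = (∫ ω, Z ω ∂P) * ∫ z, g z ∂(Q k) := by
  have hX : Measurable (X s k) := (hE.adapted s k).mono (ℱ.le _) le_rfl
  have hind : IndepFun Z (fun ω => g (X s k ω)) P := by
    rw [IndepFun_iff_Indep]
    refine indep_of_indep_of_le_left (indep_of_indep_of_le_right (hE.indep s k).symm ?_) ?_
    · have h : (fun ω => g (X s k ω)) = g ∘ X s k := rfl
      rw [h, ← MeasurableSpace.comap_comp]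
      exact MeasurableSpace.comap_mono hg.comap_le
    · exact hZ.comap_le
  rw [hind.integral_fun_mul_eq_mul_integral (hZ.mono (ℱ.le s) le_rfl).aestronglyMeasurable
    (hg.comp hX).aestronglyMeasurable, ← hE.law s k,
    integral_map hX.aemeasurable hg.aestronglyMeasurable]

/-- Conditional expectations of a function of the pulled arm pair and its draw, integrated against
a nonnegative weight that depends on the past. -/
lemma integral_mul_epoch_le (hE : IsEnvironment P ℱ Q X) (hi : ∀ s, Measurable[ℱ s] (i s)) (s : ℕ)
    {Z : Ω → ℝ} (hZ : Measurable[ℱ s] Z) (hZi : Integrable Z P) (hZ0 : ∀ ω, 0 ≤ Z ω)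
    {g : Arm K D → Outcome D → ℝ} (hg : ∀ b, Measurable (g b)) {B : ℝ}
    (hB : ∀ b z, |g b z| ≤ B) {c : ℝ} (hc : ∀ b, ∫ z, g b z ∂(Q b.1) ≤ c) :
    Integrable (fun ω => Z ω * g (i s ω) (X s (i s ω).1 ω)) P ∧
      ∫ ω, Z ω * g (i s ω) (X s (i s ω).1 ω) ∂P ≤ c * ∫ ω, Z ω ∂P := by
  have hX : ∀ k, Measurable (X s k) := fun k => (hE.adapted s k).mono (ℱ.le _) le_rfl
  have hint : ∀ Y : Ω → ℝ, Integrable Y P → ∀ h : Ω → ℝ, Measurable h → (∀ ω, |h ω| ≤ B) →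
      Integrable (fun ω => Y ω * h ω) P := fun Y hY h hh hhB =>
    hY.mul_bdd (c := B) hh.aestronglyMeasurable (Filter.Eventually.of_forall hhB)
  have hgm : Measurable fun ω => g (i s ω) (X s (i s ω).1 ω) :=
    (measurable_epoch hE hi hg (Nat.lt_succ_self s)).mono (ℱ.le _) le_rfl
  refine ⟨hint Z hZi _ hgm fun ω => hB _ _, ?_⟩
  have hZb : ∀ b, Measurable[ℱ s] fun ω => if i s ω = b then Z ω else 0 := fun b =>
    Measurable.ite (hi s (measurableSet_singleton b)) hZ measurable_const
  have hZbi : ∀ b, Integrable (fun ω => if i s ω = b then Z ω else 0) P := fun b => by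
    refine hZi.mono ((hZb b).mono (ℱ.le s) le_rfl).aestronglyMeasurable
      (Filter.Eventually.of_forall fun ω => ?_)
    split_ifs
    · exact le_rfl
    · simp
  -- Splitting over the finitely many values of the choice leaves a fixed macro-arm in each summand,
  -- whose draw is independent of the past.
  have e1 : ∀ ω, Z ω * g (i s ω) (X s (i s ω).1 ω) =
      ∑ b, (if i s ω = b then Z ω else 0) * g b (X s b.1 ω) := by
    intro ω
    simp only [ite_mul, zero_mul, Finset.sum_ite_eq, Finset.mem_univ, if_true]
  have e2 : ∀ ω, Z ω = ∑ b, if i s ω = b then Z ω else 0 := by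
    intro ω
    simp
  calc ∫ ω, Z ω * g (i s ω) (X s (i s ω).1 ω) ∂P
      = ∑ b, ∫ ω, (if i s ω = b then Z ω else 0) * g b (X s b.1 ω) ∂P := by
        rw [← integral_finsetSum]
        · exact integral_congr_ae (Filter.Eventually.of_forall e1)
        · exact fun b _ => hint _ (hZbi b) _ ((hg b).comp (hX b.1)) fun ω => hB _ _
    _ = ∑ b, (∫ ω, if i s ω = b then Z ω else 0 ∂P) * ∫ z, g b z ∂(Q b.1) :=
        Finset.sum_congr rfl fun b _ => integral_mul_draw hE s b.1 (hZb b) (hg b)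
    _ ≤ ∑ b, (∫ ω, if i s ω = b then Z ω else 0 ∂P) * c := by
        refine Finset.sum_le_sum fun b _ => mul_le_mul_of_nonneg_left (hc b) ?_
        refine integral_nonneg fun ω => ?_
        dsimp only
        split_ifs
        · exact hZ0 ω
        · exact le_rfl
    _ = c * ∫ ω, Z ω ∂P := by
        rw [← Finset.sum_mul, ← integral_finsetSum _ fun b _ => hZbi b, mul_comm]
        congr 1
        exact integral_congr_ae (Filter.Eventually.of_forall fun ω => (e2 ω).symm)

end Measurability

/-! ### Concentration of the noise -/

section Draws

variable {K D : ℕ} {Ω : Type*} [m : MeasurableSpace Ω] {P : Measure Ω} [IsProbabilityMeasure P]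
  {ℱ : Filtration ℕ m} {Q : Fin K → Measure (Outcome D)} [∀ k, IsProbabilityMeasure (Q k)]
  {X : ℕ → Fin K → Ω → Outcome D} {i : ℕ → Ω → Arm K D}

/-- The exponential supermartingale of the noise of one arm pair. -/
lemma integral_exp_noiseSum_le (hE : IsEnvironment P ℱ Q X) (hi : ∀ s, Measurable[ℱ s] (i s))
    (a : Arm K D) (l ψ : ℝ) (h : ∫ z, Real.exp (l * noise Q a z) ∂(Q a.1) ≤ Real.exp ψ) (n : ℕ) :
    Integrable (fun ω => Real.exp (l * noiseSum Q (fun s k => X s k ω) (fun s => i s ω) a n -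
        pulls (fun s => i s ω) a n * ψ)) P ∧
      ∫ ω, Real.exp (l * noiseSum Q (fun s k => X s k ω) (fun s => i s ω) a n -
        pulls (fun s => i s ω) a n * ψ) ∂P ≤ 1 := by
  induction n with
  | zero => simp [noiseSum, pulls]
  | succ n ih =>
    -- Factor by which one epoch multiplies the process; it is 1 when another pair is pulled.
    set g : Arm K D → Outcome D → ℝ := fun b z =>
      if b = a then Real.exp (l * noise Q a z - ψ) else 1 with hgdef
    have hg : ∀ b, Measurable (g b) := by
      intro b
      simp only [hgdef]
      split_ifs
      · exact (((measurable_noise Q a).const_mul l).sub_const ψ).exp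
      · exact measurable_const
    have hB : ∀ b z, |g b z| ≤ Real.exp (|l| * waitTime a.2 + |ψ|) := by
      intro b z
      simp only [hgdef]
      split_ifs
      · rw [abs_of_pos (Real.exp_pos _)]
        refine Real.exp_le_exp.2 ?_
        have h1 : l * noise Q a z ≤ |l| * waitTime a.2 :=
          (le_abs_self _).trans (by
            rw [abs_mul]
            exact mul_le_mul_of_nonneg_left (abs_noise_le Q a z) (abs_nonneg l))
        linarith [neg_abs_le ψ]
      · rw [abs_one]
        exact Real.one_le_exp (by positivity)
    have hc : ∀ b, ∫ z, g b z ∂(Q b.1) ≤ 1 := by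
      intro b
      simp only [hgdef]
      split_ifs with hb
      · subst hb
        simp only [Real.exp_sub, integral_div]
        exact div_le_one_of_le₀ h (Real.exp_pos _).le
      · simp
    have hM : Measurable[ℱ n] fun ω =>
        Real.exp (l * noiseSum Q (fun s k => X s k ω) (fun s => i s ω) a n -
          pulls (fun s => i s ω) a n * ψ) := by
      have h1 := measurable_noiseSum hE hi a n
      have h2 : Measurable[ℱ n] fun ω => (pulls (fun s => i s ω) a n : ℝ) :=
        (Measurable.of_discrete (f := fun n : ℕ => (n : ℝ))).comp (measurable_pulls hi a n)
      exact ((h1.const_mul l).sub (h2.mul_const ψ)).exp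
    have hstep := integral_mul_epoch_le hE hi n hM ih.1 (fun ω => (Real.exp_pos _).le) hg hB hc
    have e : ∀ ω, Real.exp (l * noiseSum Q (fun s k => X s k ω) (fun s => i s ω) a (n + 1) -
        pulls (fun s => i s ω) a (n + 1) * ψ) =
        Real.exp (l * noiseSum Q (fun s k => X s k ω) (fun s => i s ω) a n -
          pulls (fun s => i s ω) a n * ψ) * g (i n ω) (X n (i n ω).1 ω) := by
      intro ω
      rw [noiseSum_succ, pulls_succ]
      simp only [hgdef]
      split_ifs
      · rw [← Real.exp_add]
        congr 1
        push_cast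
        ring
      · simp
    simp only [e]
    exact ⟨hstep.1, hstep.2.trans (by linarith [ih.2])⟩

/-- Markov's inequality for the exponential supermartingale. The pull count is fixed because the
best exponent depends on it. -/
lemma measureReal_pulls_eq_le (hE : IsEnvironment P ℱ Q X) (hi : ∀ s, Measurable[ℱ s] (i s))
    (a : Arm K D) {σ : ℝ} (hσ : σ = 1 ∨ σ = -1) (s n : ℕ) (hn : 1 ≤ n) :
    P.real {ω | pulls (fun s => i s ω) a s = n ∧
      alpha a.2 * Real.log s + beta a.2 * √(Real.log s * n) ≤
        σ * noiseSum Q (fun s k => X s k ω) (fun s => i s ω) a s} ≤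
      Real.exp (-(4 * Real.log s)) := by
  obtain ⟨l, hl0, hl4, hl⟩ := exists_chernoff_exponent (n := n) (alpha_nonneg a.2) (beta_pos a.2)
    (Real.log_natCast_nonneg s) hn
  set ψ := beta a.2 ^ 2 / 8 * l ^ 2 / (2 * (1 - alpha a.2 * l / 4)) with hψ
  set y := alpha a.2 * Real.log s + beta a.2 * √(Real.log s * n) with hy
  have hmgf := integral_exp_noise_le Q a hσ hl0 hl4
  simp only [← mul_assoc] at hmgf
  obtain ⟨hM1, hM2⟩ := integral_exp_noiseSum_le hE hi a (l * σ) ψ hmgf s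
  have hmarkov := mul_meas_ge_le_integral_of_nonneg
    (Filter.Eventually.of_forall fun ω => (Real.exp_pos _).le) hM1 (Real.exp (l * y - n * ψ))
  have hsub : {ω | pulls (fun s => i s ω) a s = n ∧
      y ≤ σ * noiseSum Q (fun s k => X s k ω) (fun s => i s ω) a s} ⊆
      {ω | Real.exp (l * y - n * ψ) ≤
        Real.exp (l * σ * noiseSum Q (fun s k => X s k ω) (fun s => i s ω) a s -
          pulls (fun s => i s ω) a s * ψ)} := by
    rintro ω ⟨h1, h2⟩
    refine Real.exp_le_exp.2 ?_
    rw [h1, mul_assoc]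
    linarith [mul_le_mul_of_nonneg_left h2 hl0]
  have h1 := (mul_le_mul_of_nonneg_left (measureReal_mono hsub (measure_ne_top P _))
    (Real.exp_pos (l * y - n * ψ)).le).trans (hmarkov.trans hM2)
  have h2 : Real.exp (-(4 * Real.log s)) * Real.exp (l * y - n * ψ) = 1 := by
    rw [← Real.exp_add, ← hl]
    simp
  rw [mul_comm, ← h2] at h1
  exact le_of_mul_le_mul_right h1 (Real.exp_pos _)

/-- A deviation of the empirical ratio after `s` epochs has probability at most `s⁻³`. -/
lemma measureReal_deviates_le (hE : IsEnvironment P ℱ Q X) (hi : ∀ s, Measurable[ℱ s] (i s))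
    (a : Arm K D) {σ : ℝ} (hσ : σ = 1 ∨ σ = -1) (s : ℕ) :
    P.real {ω | Deviates Q (fun s k => X s k ω) (fun s => i s ω) a σ s} ≤ 1 / (s : ℝ) ^ 3 := by
  have hsub : {ω | Deviates Q (fun s k => X s k ω) (fun s => i s ω) a σ s} ⊆
      ⋃ n ∈ Finset.Icc 1 s, {ω | pulls (fun s => i s ω) a s = n ∧
        alpha a.2 * Real.log s + beta a.2 * √(Real.log s * n) ≤
          σ * noiseSum Q (fun s k => X s k ω) (fun s => i s ω) a s} := by
    intro ω hω
    simp only [Set.mem_iUnion]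
    exact ⟨_, Finset.mem_Icc.2 ⟨hω.1, pulls_le _ _ _⟩, rfl, hω.2⟩
  refine (measureReal_mono hsub (measure_ne_top P _)).trans ?_
  refine (measureReal_biUnion_finset_le _ _).trans ?_
  -- For `s = 0` both sides vanish: the union is empty, and the right side is `1 / 0 = 0`.
  rcases Nat.eq_zero_or_pos s with rfl | hs
  · simp
  have hs' : (0 : ℝ) < s := by exact_mod_cast hs
  calc _ ≤ ∑ n ∈ Finset.Icc 1 s, Real.exp (-(4 * Real.log s)) :=
        Finset.sum_le_sum fun n hn =>
          measureReal_pulls_eq_le hE hi a hσ s n (Finset.mem_Icc.1 hn).1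
    _ = s * Real.exp (-(4 * Real.log s)) := by simp
    _ = 1 / (s : ℝ) ^ 3 := by
        have : Real.exp (4 * Real.log s) = (s : ℝ) ^ 4 := by
          rw [show (4 : ℝ) * Real.log s = ((4 : ℕ) : ℝ) * Real.log s by norm_num,
            Real.exp_nat_mul, Real.exp_log hs']
        rw [Real.exp_neg, this]
        field_simp

lemma sum_one_div_cube_le (N : ℕ) : ∑ s ∈ Finset.range N, 1 / (s : ℝ) ^ 3 ≤ 2 := by
  -- The strengthened bound telescopes by `1/n³ ≤ 2/(n (n + 1))`; division by zero makes the start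
  -- `N = 0` harmless.
  suffices h : ∑ s ∈ Finset.range N, 1 / (s : ℝ) ^ 3 ≤ 2 - 2 / (N : ℝ) from
    h.trans (sub_le_self _ (by positivity))
  induction N with
  | zero => simp
  | succ n ih =>
    rw [Finset.sum_range_succ]
    rcases Nat.eq_zero_or_pos n with rfl | hn
    · simp
    · have hn1 : (1 : ℝ) ≤ n := by exact_mod_cast hn
      have h : 1 / (n : ℝ) ^ 3 ≤ 2 / n - 2 / ((n + 1 : ℕ) : ℝ) := by
        have e : 2 / (n : ℝ) - 2 / ((n + 1 : ℕ) : ℝ) = 2 / (n * (n + 1)) := by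
          push_cast
          field_simp
          ring
        rw [e, div_le_div_iff₀ (by positivity) (by positivity)]
        nlinarith [mul_nonneg (zero_le_one.trans hn1) (sub_nonneg.2 hn1)]
      linarith

/-! ### Reward of a policy and the pulls of suboptimal arm pairs -/

/-- Upper bound on what has been gained when `e` units of time have been consumed: the optimal
ratio per unit of time within the budget, and one unit for exceeding the budget. -/
noncomputable def potential (c : ℝ) (T e : ℕ) : ℝ := c * (min e T : ℕ) + if T < e then 1 else 0

lemma potential_mono {c : ℝ} (hc : 0 ≤ c) (T : ℕ) : Monotone (potential c T) := by
  intro e f h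
  unfold potential
  refine add_le_add (mul_le_mul_of_nonneg_left (by exact_mod_cast min_le_min_right T h) hc) ?_
  split_ifs
  · exact le_rfl
  · omega
  · norm_num
  · exact le_rfl

/-- Waiting beyond the budget is no better than stopping at the budget, up to the unit that the
potential grants for exceeding it. -/
lemma exists_reward_sub_potential_le (c : ℝ) {T e : ℕ} (he : e < T) (j : Fin D) :
    ∃ j' : Fin D, ∀ z, reward j z - (potential c T (e + cost j z) - potential c T e) ≤
      reward j' z - c * cost j' z := by
  have hpe : potential c T e = c * e := by
    unfold potential
    rw [min_eq_left he.le, if_neg (by omega), add_zero]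
  rcases le_or_gt (waitTime j) (T - e) with hj | hj
  · refine ⟨j, fun z => ?_⟩
    have h := cost_le j z
    rw [hpe, potential, min_eq_left (by omega), if_neg (by omega)]
    push_cast
    linarith
  · have hD := waitTime_le j
    refine ⟨⟨T - e - 1, by omega⟩, fun z => ?_⟩
    have hw : waitTime (⟨T - e - 1, by omega⟩ : Fin D) = T - e := by
      simp only [waitTime]
      omega
    have hmin : min (e + cost j z) T = e + cost (⟨T - e - 1, by omega⟩ : Fin D) z := by
      simp only [cost, hw]
      omega
    rw [hpe, potential, hmin]
    push_cast
    have hr := reward_le_one j z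
    have hr' := reward_nonneg (⟨T - e - 1, by omega⟩ : Fin D) z
    split_ifs with h
    · linarith
    · have hτ : waitTime z.2 ≤ T - e := by
        simp only [cost] at h
        omega
      have e1 : reward j z = reward (⟨T - e - 1, by omega⟩ : Fin D) z := by
        unfold reward
        rw [hw, if_pos hτ, if_pos (hτ.trans hj.le)]
      linarith

lemma integral_reward_sub_cost (a : Arm K D) (c : ℝ) :
    ∫ z, (reward a.2 z - c * cost a.2 z) ∂(Q a.1) = (ratio Q a - c) * meanWait Q a := by
  rw [integral_sub (integrable_reward _ _) ((integrable_cost _ _).const_mul _), integral_const_mul,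
    sub_mul, ratio_mul_meanWait]
  rfl

/-- No policy collects more than the optimal ratio times the budget, up to one unit. -/
lemma integral_gameReward_le (hE : IsEnvironment P ℱ Q X) (hi : ∀ s, Measurable[ℱ s] (i s))
    (T : ℕ) {c : ℝ} (hc0 : 0 ≤ c) (hc : ∀ a, ratio Q a ≤ c) :
    ∫ ω, gameReward (fun s k => X s k ω) (fun s => i s ω) T .untilExhausted ∂P ≤ c * T + 1 := by
  set g : ℕ → Arm K D → Outcome D → ℝ := fun e b z =>
    reward b.2 z - (potential c T (e + cost b.2 z) - potential c T e) with hgdef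
  have hpot : ∀ e, 0 ≤ potential c T e ∧ potential c T e ≤ c * T + 1 := by
    intro e
    unfold potential
    have h1 : ((min e T : ℕ) : ℝ) ≤ T := by exact_mod_cast min_le_right e T
    have h2 := mul_le_mul_of_nonneg_left h1 hc0
    have h3 : 0 ≤ c * (min e T : ℕ) := by positivity
    split_ifs <;> constructor <;> linarith
  have hg : ∀ e b, Measurable (g e b) := fun e b =>
    (measurable_reward _).sub (((Measurable.of_discrete
      (f := fun n : ℕ => potential c T (e + n))).comp (measurable_cost _)).sub_const _)
  have hgB : ∀ e b z, |g e b z| ≤ c * T + 2 := by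
    intro e b z
    have h1 := reward_nonneg b.2 z
    have h2 := reward_le_one b.2 z
    have h3 := hpot e
    have h4 := hpot (e + cost b.2 z)
    simp only [hgdef]
    exact abs_le.2 ⟨by linarith, by linarith⟩
  have hgm : ∀ e < T, ∀ b, ∫ z, g e b z ∂(Q b.1) ≤ 0 := by
    intro e he b
    obtain ⟨j', hj'⟩ := exists_reward_sub_potential_le c he b.2
    have h1 := integral_mono (μ := Q b.1) (integrable_of_bounded (hg e b) _ (hgB e b))
      ((integrable_reward j' _).sub ((integrable_cost j' _).const_mul c)) hj'
    have h2 := integral_reward_sub_cost (Q := Q) (b.1, j') c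
    have h3 := one_le_meanWait Q (b.1, j')
    have h4 := hc (b.1, j')
    simp only [Pi.sub_apply] at h1
    refine h1.trans (h2.trans_le ?_)
    exact mul_nonpos_of_nonpos_of_nonneg (by linarith) (by linarith)
  have hstep : ∀ s, ∀ e ∈ Finset.range T, _ := fun s e he =>
    integral_mul_epoch_le hE hi s
      (Z := fun ω => if elapsed (fun s k => X s k ω) (fun s => i s ω) s = e then 1 else 0)
      (Measurable.ite (measurable_elapsed hE hi s (measurableSet_singleton e))
        measurable_const measurable_const)
      (integrable_of_bounded
        (Measurable.ite (((measurable_elapsed hE hi s).mono (ℱ.le s) le_rfl)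
          (measurableSet_singleton e)) measurable_const measurable_const) 1
        (fun ω => by split_ifs <;> simp))
      (fun ω => by split_ifs <;> norm_num) (hg e) (hgB e) (hgm e (Finset.mem_range.1 he))
  have hpath : ∀ ω, gameReward (fun s k => X s k ω) (fun s => i s ω) T .untilExhausted ≤
      (∑ s ∈ Finset.range T, ∑ e ∈ Finset.range T,
        (if elapsed (fun s k => X s k ω) (fun s => i s ω) s = e then 1 else 0) *
          g e (i s ω) (X s (i s ω).1 ω)) + (c * T + 1) := by
    intro ω
    rw [gameReward_untilExhausted_eq]
    set el := elapsed (fun s k => X s k ω) (fun s => i s ω) with hel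
    -- The potential differences telescope. After exhaustion no reward is counted, and monotonicity
    -- of the potential preserves the inequality.
    have h1 : ∀ s ∈ Finset.range T,
        (if el s < T then epochReward (fun s k => X s k ω) (fun s => i s ω) s else 0) ≤
        (∑ e ∈ Finset.range T, (if el s = e then 1 else 0) * g e (i s ω) (X s (i s ω).1 ω)) +
          (potential c T (el (s + 1)) - potential c T (el s)) := by
      intro s _
      simp only [ite_mul, one_mul, zero_mul, Finset.sum_ite_eq, Finset.mem_range]
      have h2 : el (s + 1) = el s + cost (i s ω).2 (X s (i s ω).1 ω) := by
        rw [hel, elapsed_succ]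
        rfl
      split_ifs
      · simp only [hgdef, h2, epochReward]
        linarith
      · have := potential_mono hc0 T (h2 ▸ Nat.le_add_right (el s) _ : el s ≤ el (s + 1))
        linarith
    refine (Finset.sum_le_sum h1).trans ?_
    rw [Finset.sum_add_distrib, Finset.sum_range_sub (fun s => potential c T (el s))]
    have h3 := (hpot (el T)).2
    have h4 := (hpot (el 0)).1
    linarith
  have hint : Integrable (fun ω => ∑ s ∈ Finset.range T, ∑ e ∈ Finset.range T,
        (if elapsed (fun s k => X s k ω) (fun s => i s ω) s = e then (1 : ℝ) else 0) *
          g e (i s ω) (X s (i s ω).1 ω)) P :=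
    integrable_finsetSum _ fun s _ => integrable_finsetSum _ fun e he => (hstep s e he).1
  have hI := integral_mono (integrable_gameReward hE hi T .untilExhausted)
    (hint.add (integrable_const (c * T + 1))) hpath
  refine hI.trans ?_
  simp only [Pi.add_apply]
  rw [integral_add hint (integrable_const _), integral_finsetSum _ fun s _ =>
    integrable_finsetSum _ fun e he => (hstep s e he).1]
  have h0 : ∀ s ∈ Finset.range T, ∫ ω, ∑ e ∈ Finset.range T,
      (if elapsed (fun s k => X s k ω) (fun s => i s ω) s = e then (1 : ℝ) else 0) *
          g e (i s ω) (X s (i s ω).1 ω) ∂P ≤ 0 := by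
    intro s _
    rw [integral_finsetSum _ fun e he => (hstep s e he).1]
    exact Finset.sum_nonpos fun e he => ((hstep s e he).2).trans_eq (zero_mul _)
  have h1 := Finset.sum_nonpos h0
  simp only [integral_const, probReal_univ, one_smul]
  linarith

/-- A policy loses the gap for the time it spends on suboptimal arm pairs, and nothing else. -/
lemma le_integral_gameReward_add (hE : IsEnvironment P ℱ Q X) (hi : ∀ s, Measurable[ℱ s] (i s))
    (T : ℕ) :
    (⨆ b : Arm K D, ratio Q b) * T ≤
      ∫ ω, gameReward (fun s k => X s k ω) (fun s => i s ω) T .untilExhausted ∂P +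
        ∑ a, gap Q a * meanWait Q a *
          ∫ ω, gamePulls (fun s k => X s k ω) (fun s => i s ω) a T ∂P := by
  set c := ⨆ b : Arm K D, ratio Q b with hcdef
  have hc0 : 0 ≤ c := Real.iSup_nonneg fun b => ratio_nonneg Q b
  set g : Arm K D → Outcome D → ℝ := fun b z =>
    -(reward b.2 z - c * cost b.2 z) - gap Q b * meanWait Q b with hgdef
  have hg : ∀ b, Measurable (g b) := fun b =>
    (((measurable_reward _).sub ((measurable_cost_real _).const_mul _)).neg).sub_const _
  have hgB : ∀ b z, |g b z| ≤ 1 + c * D + D := by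
    intro b z
    have h1 := reward_nonneg b.2 z
    have h2 := reward_le_one b.2 z
    have hD : (waitTime b.2 : ℝ) ≤ D := by exact_mod_cast waitTime_le b.2
    have h3 : c * cost b.2 z ≤ c * D :=
      mul_le_mul_of_nonneg_left ((cost_le_real b.2 z).trans hD) hc0
    have h4 : 0 ≤ c * cost b.2 z := by positivity
    have h5 := one_le_meanWait Q b
    have h6 : gap Q b * meanWait Q b ≤ 1 * D :=
      mul_le_mul (gap_le_one Q b) ((meanWait_le Q b).trans hD) (by linarith) zero_le_one
    have h7 := mul_nonneg (gap_nonneg Q b) (zero_le_one.trans h5)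
    simp only [hgdef]
    exact abs_le.2 ⟨by linarith, by linarith⟩
  have hgm : ∀ b, ∫ z, g b z ∂(Q b.1) ≤ 0 := by
    intro b
    have hint : Integrable (fun z => reward b.2 z - c * cost b.2 z) (Q b.1) :=
      (integrable_reward _ _).sub ((integrable_cost _ _).const_mul _)
    have hneg : Integrable (fun z => -(reward b.2 z - c * cost b.2 z)) (Q b.1) := hint.neg
    simp only [hgdef]
    rw [integral_sub hneg (integrable_const _), integral_neg, integral_reward_sub_cost]
    simp only [integral_const, probReal_univ, one_smul, gap, ← hcdef]
    linarith
  have hstep : ∀ s, _ := fun s =>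
    integral_mul_epoch_le hE hi s
      (Z := fun ω => if elapsed (fun s k => X s k ω) (fun s => i s ω) s < T then 1 else 0)
      (Measurable.ite (measurable_elapsed hE hi s measurableSet_Iio)
        measurable_const measurable_const)
      (integrable_of_bounded
        (Measurable.ite (((measurable_elapsed hE hi s).mono (ℱ.le s) le_rfl)
          measurableSet_Iio) measurable_const measurable_const) 1
        (fun ω => by split_ifs <;> simp))
      (fun ω => by split_ifs <;> norm_num) hg hgB hgm
  have hpath : ∀ ω, c * T - gameReward (fun s k => X s k ω) (fun s => i s ω) T .untilExhausted -
      ∑ a, gap Q a * meanWait Q a * gamePulls (fun s k => X s k ω) (fun s => i s ω) a T ≤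
      ∑ s ∈ Finset.range T,
        (if elapsed (fun s k => X s k ω) (fun s => i s ω) s < T then 1 else 0) *
          g (i s ω) (X s (i s ω).1 ω) := by
    intro ω
    -- The epochs that start within the budget consume at least `T`, so `γ* T` may be replaced by
    -- `γ*` times their total time.
    have h1 := mul_le_mul_of_nonneg_left
      (le_sum_epochCost (fun s k => X s k ω) (fun s => i s ω) T) hc0
    have h2 : ∑ a, gap Q a * meanWait Q a *
        gamePulls (fun s k => X s k ω) (fun s => i s ω) a T =
        ∑ s ∈ Finset.range T, if elapsed (fun s k => X s k ω) (fun s => i s ω) s < T then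
          gap Q (i s ω) * meanWait Q (i s ω) else 0 := by
      simp only [gamePulls, Finset.mul_sum]
      rw [Finset.sum_comm]
      refine Finset.sum_congr rfl fun s _ => ?_
      split_ifs with h <;> simp [h]
    rw [gameReward_untilExhausted_eq, h2]
    have h3 : ∑ s ∈ Finset.range T,
        (if elapsed (fun s k => X s k ω) (fun s => i s ω) s < T then 1 else 0) *
          g (i s ω) (X s (i s ω).1 ω) =
        c * (∑ s ∈ Finset.range T,
          if elapsed (fun s k => X s k ω) (fun s => i s ω) s < T then
            (epochCost (fun s k => X s k ω) (fun s => i s ω) s : ℝ) else 0) -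
        (∑ s ∈ Finset.range T,
          if elapsed (fun s k => X s k ω) (fun s => i s ω) s < T then
            epochReward (fun s k => X s k ω) (fun s => i s ω) s else 0) -
        ∑ s ∈ Finset.range T, if elapsed (fun s k => X s k ω) (fun s => i s ω) s < T then
          gap Q (i s ω) * meanWait Q (i s ω) else 0 := by
      rw [Finset.mul_sum, ← Finset.sum_sub_distrib, ← Finset.sum_sub_distrib]
      refine Finset.sum_congr rfl fun s _ => ?_
      split_ifs
      · simp only [hgdef, epochReward, epochCost]
        ring
      · simp
    rw [h3]
    linarith
  have hp : Integrable (fun ω => ∑ a, gap Q a * meanWait Q a *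
      gamePulls (fun s k => X s k ω) (fun s => i s ω) a T) P :=
    integrable_finsetSum _ fun a _ => (integrable_gamePulls hE hi a T).const_mul _
  have hr := integrable_gameReward hE hi T .untilExhausted
  have hcr : Integrable (fun ω => c * T -
      gameReward (fun s k => X s k ω) (fun s => i s ω) T .untilExhausted) P :=
    (integrable_const (c * T)).sub hr
  have hI := integral_mono (hcr.sub hp)
    (integrable_finsetSum _ fun s _ => (hstep s).1) hpath
  simp only [Pi.sub_apply] at hI
  rw [integral_sub hcr hp, integral_sub (integrable_const _) hr,
    integral_finsetSum _ fun s _ => (hstep s).1,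
    integral_finsetSum _ fun a _ => (integrable_gamePulls hE hi a T).const_mul _] at hI
  simp only [integral_const, probReal_univ, one_smul, integral_const_mul] at hI
  have h0 := Finset.sum_nonpos fun s (_ : s ∈ Finset.range T) => ((hstep s).2).trans_eq (zero_mul _)
  linarith

end Draws

/-! ### The choices of Wait-UCB -/

section Path

variable {K D : ℕ} (Q : Fin K → Measure (Outcome D)) (x : ℕ → Fin K → Outcome D) (i : ℕ → Arm K D)
  (a : Arm K D) (n : ℕ)

lemma pulls_le_sum_cost : (pulls i a n : ℝ) ≤
    ∑ s ∈ Finset.range n, if i s = a then (epochCost x i s : ℝ) else 0 := by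
  unfold pulls
  rw [Finset.card_filter]
  push_cast
  refine Finset.sum_le_sum fun s _ => ?_
  split_ifs
  · exact_mod_cast one_le_epochCost x i s
  · exact le_rfl

lemma noiseSum_eq (h : 1 ≤ pulls i a n) : noiseSum Q x i a n =
    (ratioEst x i a n - ratio Q a) *
      ∑ s ∈ Finset.range n, if i s = a then (epochCost x i s : ℝ) else 0 := by
  have h1 : (1 : ℝ) ≤ pulls i a n := by exact_mod_cast h
  have h2 := pulls_le_sum_cost x i a n
  have h3 : noiseSum Q x i a n =
      (∑ s ∈ Finset.range n, if i s = a then epochReward x i s else 0) -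
        ratio Q a * ∑ s ∈ Finset.range n, if i s = a then (epochCost x i s : ℝ) else 0 := by
    rw [Finset.mul_sum, ← Finset.sum_sub_distrib]
    refine Finset.sum_congr rfl fun s _ => ?_
    split_ifs with hs
    · subst hs
      rfl
    · simp
  rw [h3, ratioEst, sub_mul, div_mul_cancel₀]
  linarith

lemma pulls_mul_upDev (h : 1 ≤ pulls i a n) : pulls i a n * upDev i a n =
    alpha a.2 * Real.log n + beta a.2 * √(Real.log n * pulls i a n) := by
  have h1 : (0 : ℝ) < pulls i a n := by exact_mod_cast h
  have h2 : √(Real.log n * pulls i a n) = √(Real.log n / pulls i a n) * pulls i a n := by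
    have h3 : Real.log n * pulls i a n = Real.log n / pulls i a n * (pulls i a n : ℝ) ^ 2 := by
      field_simp
    rw [h3, Real.sqrt_mul' _ (sq_nonneg _), Real.sqrt_sq h1.le]
  rw [h2, upDev]
  field_simp

lemma upDev_nonneg : 0 ≤ upDev i a n := by
  have h1 := alpha_nonneg a.2
  have h2 := (beta_pos a.2).le
  have h3 := Real.log_natCast_nonneg n
  unfold upDev
  positivity

/-- The noise sum is the error of the ratio times the consumed time, which is at least the number of
pulls. Thus the random denominator of the estimate disappears. -/
lemma deviates_of_le_mul {σ : ℝ} (h : 1 ≤ pulls i a n)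
    (hσ : upDev i a n ≤ σ * (ratioEst x i a n - ratio Q a)) : Deviates Q x i a σ n := by
  refine ⟨h, ?_⟩
  rw [← pulls_mul_upDev i a n h, noiseSum_eq Q x i a n h, ← mul_assoc, mul_comm]
  exact mul_le_mul hσ (pulls_le_sum_cost x i a n) (Nat.cast_nonneg _)
    ((upDev_nonneg i a n).trans hσ)

/-- After sufficiently many pulls, the deviation allowed by Wait-UCB is at most half the gap. -/
lemma two_mul_upDev_le {Δ ℓ : ℝ} (hΔ : 0 < Δ) (hℓ : Real.log n ≤ ℓ)
    (h : (beta a.2 + √(beta a.2 ^ 2 + 2 * Δ * alpha a.2)) ^ 2 * ℓ / Δ ^ 2 < pulls i a n) :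
    2 * upDev i a n ≤ Δ := by
  have hα := alpha_nonneg a.2
  have hβ := beta_pos a.2
  have hlog := Real.log_natCast_nonneg n
  set α := alpha a.2
  set β := beta a.2
  have hR2 : √(β ^ 2 + 2 * Δ * α) ^ 2 = β ^ 2 + 2 * Δ * α := Real.sq_sqrt (by positivity)
  have hR0 : 0 ≤ √(β ^ 2 + 2 * Δ * α) := Real.sqrt_nonneg _
  set R := √(β ^ 2 + 2 * Δ * α)
  have hN : (0 : ℝ) < pulls i a n :=
    lt_of_le_of_lt (div_nonneg (mul_nonneg (sq_nonneg _) (hlog.trans hℓ)) (sq_nonneg _)) h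
  have hy0 : 0 ≤ √(Real.log n / pulls i a n) := Real.sqrt_nonneg _
  have hy2 : √(Real.log n / pulls i a n) ^ 2 = Real.log n / pulls i a n :=
    Real.sq_sqrt (by positivity)
  unfold upDev
  rw [← hy2]
  set y := √(Real.log n / pulls i a n)
  have hyq : y ≤ Δ / (β + R) := by
    rw [le_div_iff₀ (by positivity)]
    refine le_of_sq_le_sq ?_ hΔ.le
    rw [div_lt_iff₀ (by positivity)] at h
    rw [mul_pow, hy2, div_mul_eq_mul_div, div_le_iff₀ hN]
    have := mul_le_mul_of_nonneg_left hℓ (sq_nonneg (β + R))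
    linarith
  -- `Δ / (β + R)` is the positive root of `2 (α y² + β y) = Δ`, rationalised so that it also makes
  -- sense for `α = 0`.
  have hq : 2 * (α * (Δ / (β + R)) ^ 2 + β * (Δ / (β + R))) = Δ := by
    have hne : β + R ≠ 0 := by positivity
    have h1 : 2 * (α * (Δ / (β + R)) ^ 2 + β * (Δ / (β + R))) =
        Δ * (2 * Δ * α + 2 * β ^ 2 + 2 * β * R) / (β + R) ^ 2 := by
      field_simp
      ring
    rw [h1, div_eq_iff (by positivity)]
    have h2 : (β + R) ^ 2 = 2 * Δ * α + 2 * β ^ 2 + 2 * β * R := by linarith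
    rw [h2]
  rw [Real.sqrt_sq hy0, ← hq]
  gcongr

/-- If a suboptimal pair is chosen after sufficiently many pulls, then its empirical ratio or that
of an optimal pair deviates from the mean. -/
lemma deviates_of_ucb_le {o : Arm K D} (ho : ratio Q o = ⨆ b : Arm K D, ratio Q b)
    (hucb : ucb x i o n ≤ ucb x i a n) (ha : 0 < gap Q a) {ℓ : ℝ} (hℓ : Real.log n ≤ ℓ)
    (h : (beta a.2 + √(beta a.2 ^ 2 + 2 * gap Q a * alpha a.2)) ^ 2 * ℓ / gap Q a ^ 2 <
      pulls i a n) :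
    Deviates Q x i o (-1) n ∨ Deviates Q x i a 1 n := by
  have hdev := two_mul_upDev_le i a n ha hℓ h
  have hNa : 1 ≤ pulls i a n := by
    have h0 : (0 : ℝ) < pulls i a n :=
      lt_of_le_of_lt (div_nonneg (mul_nonneg (sq_nonneg _)
        ((Real.log_natCast_nonneg n).trans hℓ)) (sq_nonneg _)) h
    exact_mod_cast h0
  rw [ucb, ucb, if_neg (by omega : ¬ pulls i a n = 0)] at hucb
  have hNo : 1 ≤ pulls i o n := by
    by_contra hc
    rw [if_pos (by omega)] at hucb
    exact absurd (top_le_iff.1 hucb) (EReal.coe_ne_top _)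
  rw [if_neg (by omega), EReal.coe_le_coe_iff] at hucb
  -- Without deviations, the bound of `o` exceeds `γ*`, while that of `a` is below `γ_a + 2 · upDev
  -- ≤ γ_a + Δ_a = γ*`, against the choice of `a`.
  by_contra hc
  rw [not_or] at hc
  have h1 := fun hle => hc.1 (deviates_of_le_mul Q x i o n hNo hle)
  have h2 := fun hle => hc.2 (deviates_of_le_mul Q x i a n hNa hle)
  rw [imp_false, not_le] at h1 h2
  have h3 : gap Q a = ratio Q o - ratio Q a := by rw [gap, ho]
  linarith

lemma gamePulls_le {T : ℕ} (hf : FollowsWaitUCB x i T) {o : Arm K D}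
    (ho : ratio Q o = ⨆ b : Arm K D, ratio Q b) (ha : 0 < gap Q a) :
    gamePulls x i a T ≤
      (beta a.2 + √(beta a.2 ^ 2 + 2 * gap Q a * alpha a.2)) ^ 2 * Real.log T / gap Q a ^ 2 + 1 +
      ∑ s ∈ Finset.range T, (Set.indicator {s | Deviates Q x i o (-1) s} 1 s +
        Set.indicator {s | Deviates Q x i a 1 s} 1 s) := by
  set u := (beta a.2 + √(beta a.2 ^ 2 + 2 * gap Q a * alpha a.2)) ^ 2 * Real.log T / gap Q a ^ 2
    with hu
  have hu0 : 0 ≤ u :=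
    div_nonneg (mul_nonneg (sq_nonneg _) (Real.log_natCast_nonneg T)) (sq_nonneg _)
  have hc := card_pulls_le i a T u hu0
  rw [Finset.card_filter] at hc
  push_cast at hc
  refine le_trans ?_ (add_le_add hc le_rfl)
  rw [gamePulls, ← Finset.sum_add_distrib]
  refine Finset.sum_le_sum fun s hs => ?_
  have hn1 : (0 : ℝ) ≤ Set.indicator {s | Deviates Q x i o (-1) s} 1 s :=
    Set.indicator_nonneg (fun _ _ => zero_le_one) s
  have hn2 : (0 : ℝ) ≤ Set.indicator {s | Deviates Q x i a 1 s} 1 s :=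
    Set.indicator_nonneg (fun _ _ => zero_le_one) s
  split_ifs with h1 h2 h2
  · linarith
  · have hlog : Real.log s ≤ Real.log T := by
      rcases Nat.eq_zero_or_pos s with rfl | hs0
      · simpa using Real.log_natCast_nonneg T
      · exact Real.log_le_log (by exact_mod_cast hs0)
          (by exact_mod_cast (Finset.mem_range.1 hs).le)
    have hp : u < pulls i a s := not_le.1 fun hle => h2 ⟨h1.2, hle⟩
    have hucb := hf s h1.1 o
    rw [h1.2] at hucb
    rcases deviates_of_ucb_le Q x i a s ho hucb ha hlog hp with h | h
    · rw [Set.indicator_of_mem (by exact h)]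
      simp only [Pi.one_apply]
      linarith
    · rw [Set.indicator_of_mem (s := {s | Deviates Q x i a 1 s}) (by exact h)]
      simp only [Pi.one_apply]
      linarith
  · linarith
  · linarith

end Path

/-! ### Expected pulls and regret -/

section Regret

variable {K D : ℕ} {Ω : Type*} [m : MeasurableSpace Ω] {P : Measure Ω} [IsProbabilityMeasure P]
  {ℱ : Filtration ℕ m} {Q : Fin K → Measure (Outcome D)} [∀ k, IsProbabilityMeasure (Q k)]
  {X : ℕ → Fin K → Ω → Outcome D} {i : ℕ → Ω → Arm K D}

lemma integral_gamePulls_le (hE : IsEnvironment P ℱ Q X) {T : ℕ} (hU : IsWaitUCB ℱ X i T)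
    {a o : Arm K D} (ho : ratio Q o = ⨆ b : Arm K D, ratio Q b) (ha : 0 < gap Q a) :
    ∫ ω, gamePulls (fun s k => X s k ω) (fun s => i s ω) a T ∂P ≤
      (beta a.2 + √(beta a.2 ^ 2 + 2 * gap Q a * alpha a.2)) ^ 2 * Real.log T / gap Q a ^ 2 +
        5 := by
  have hi := hU.predictable
  set u := (beta a.2 + √(beta a.2 ^ 2 + 2 * gap Q a * alpha a.2)) ^ 2 * Real.log T / gap Q a ^ 2
  set A : Arm K D → ℝ → ℕ → Set Ω := fun b σ s =>
    {ω | Deviates Q (fun s k => X s k ω) (fun s => i s ω) b σ s} with hA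
  have hm : ∀ b σ s, MeasurableSet (A b σ s) := fun b σ s => measurableSet_deviates hE hi b σ s
  have hint : ∀ b σ s, Integrable ((A b σ s).indicator (1 : Ω → ℝ)) P := fun b σ s =>
    (integrable_const (1 : ℝ)).indicator (hm b σ s)
  have hint2 : ∀ s, Integrable (fun ω => (A o (-1) s).indicator (1 : Ω → ℝ) ω +
      (A a 1 s).indicator (1 : Ω → ℝ) ω) P := fun s => (hint _ _ _).add (hint _ _ _)
  have hpath : ∀ ω, gamePulls (fun s k => X s k ω) (fun s => i s ω) a T ≤ u + 1 +
      ∑ s ∈ Finset.range T, ((A o (-1) s).indicator (1 : Ω → ℝ) ω +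
        (A a 1 s).indicator (1 : Ω → ℝ) ω) := by
    intro ω
    exact gamePulls_le Q _ _ a (hU.follows ω) ho ha
  have hI := integral_mono (integrable_gamePulls hE hi a T)
    ((integrable_const (u + 1)).add (integrable_finsetSum _ fun s _ => hint2 s)) hpath
  refine hI.trans ?_
  simp only [Pi.add_apply]
  rw [integral_add (integrable_const _) (integrable_finsetSum _ fun s _ => hint2 s),
    integral_finsetSum _ fun s _ => hint2 s]
  simp only [integral_const, probReal_univ, one_smul]
  have hs : ∀ s ∈ Finset.range T, ∫ ω, ((A o (-1) s).indicator (1 : Ω → ℝ) ω +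
      (A a 1 s).indicator (1 : Ω → ℝ) ω) ∂P ≤ 1 / (s : ℝ) ^ 3 + 1 / (s : ℝ) ^ 3 := by
    intro s _
    rw [integral_add (hint _ _ _) (hint _ _ _), integral_indicator_one (hm _ _ _),
      integral_indicator_one (hm _ _ _)]
    exact add_le_add (measureReal_deviates_le hE hi o (Or.inr rfl) s)
      (measureReal_deviates_le hE hi a (Or.inl rfl) s)
  have h1 := Finset.sum_le_sum hs
  rw [Finset.sum_add_distrib] at h1
  -- The 5 is 1 for rounding the threshold and 2 for the deviations of each of the two pairs.
  linarith [sum_one_div_cube_le T]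

lemma pseudoRegret_le (hE : IsEnvironment P ℱ Q X) {T : ℕ} (hU : IsWaitUCB ℱ X i T)
    (rule : StopRule) :
    pseudoRegret P X i T rule ≤
      2 + ∑ a ∈ subopt Q, meanWait Q a * (leadingTerm Q T a + 5) := by
  have hi := hU.predictable
  have hΩ : Nonempty Ω := P.nonempty_of_neZero
  have hne : Nonempty (Arm K D) := ⟨i 0 hΩ.some⟩
  obtain ⟨o, ho⟩ := Finite.exists_max (ratio Q)
  have ho' : ratio Q o = ⨆ b : Arm K D, ratio Q b :=
    le_antisymm (ratio_le_iSup Q o) (ciSup_le ho)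
  have hbest : (⨆ a : Arm K D, ∫ ω, gameReward (fun s k => X s k ω) (fun _ => a) T rule ∂P) ≤
      ratio Q o * T + 1 := by
    refine ciSup_le fun a => ?_
    have hconst : ∀ s, Measurable[ℱ s] ((fun _ _ => a : ℕ → Ω → Arm K D) s) :=
      fun s => measurable_const
    refine le_trans ?_ (integral_gameReward_le hE hconst T (ratio_nonneg Q o) ho)
    exact integral_mono (integrable_gameReward hE hconst T rule)
      (integrable_gameReward hE hconst T .untilExhausted)
      fun ω => gameReward_le_untilExhausted _ _ _ _
  have hlow := le_integral_gameReward_add hE hi T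
  have hrule : ∫ ω, gameReward (fun s k => X s k ω) (fun s => i s ω) T .untilExhausted ∂P ≤
      ∫ ω, gameReward (fun s k => X s k ω) (fun s => i s ω) T rule ∂P + 1 := by
    have h := integral_mono (integrable_gameReward hE hi T .untilExhausted)
      ((integrable_gameReward hE hi T rule).add (integrable_const (1 : ℝ)))
      fun ω => gameReward_untilExhausted_le _ _ _ _
    simp only [Pi.add_apply] at h
    rw [integral_add (integrable_gameReward hE hi T rule) (integrable_const _)] at h
    simpa using h
  have hsum : ∑ a, gap Q a * meanWait Q a *
      ∫ ω, gamePulls (fun s k => X s k ω) (fun s => i s ω) a T ∂P ≤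
      ∑ a ∈ subopt Q, meanWait Q a * (leadingTerm Q T a + 5) := by
    have h1 : ∑ a, gap Q a * meanWait Q a *
        ∫ ω, gamePulls (fun s k => X s k ω) (fun s => i s ω) a T ∂P =
        ∑ a ∈ subopt Q, gap Q a * meanWait Q a *
          ∫ ω, gamePulls (fun s k => X s k ω) (fun s => i s ω) a T ∂P := by
      refine (Finset.sum_subset (Finset.subset_univ _) fun a _ ha => ?_).symm
      have h0 : gap Q a = 0 :=
        le_antisymm (not_lt.1 fun h => ha ((mem_subopt Q a).2 h)) (gap_nonneg Q a)
      rw [h0]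
      ring
    rw [h1]
    refine Finset.sum_le_sum fun a ha => ?_
    have hg := (mem_subopt Q a).1 ha
    have hg1 := gap_le_one Q a
    have hw := one_le_meanWait Q a
    have h2 := integral_gamePulls_le hE hU ho' hg
    calc _ ≤ gap Q a * meanWait Q a *
          ((beta a.2 + √(beta a.2 ^ 2 + 2 * gap Q a * alpha a.2)) ^ 2 * Real.log T /
            gap Q a ^ 2 + 5) := by gcongr
      _ = meanWait Q a * (leadingTerm Q T a + gap Q a * 5) := by
          unfold leadingTerm
          field_simp
      _ ≤ _ := by
          refine mul_le_mul_of_nonneg_left ?_ (by linarith)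
          linarith
  -- Of the additive 2, one unit is the competitor's overshoot and one the learner's possible loss
  -- of the last epoch.
  rw [← ho'] at hlow
  unfold pseudoRegret
  linarith

end Regret

/-! ### Absolute constants and coarser forms -/

section Constants

variable {K D : ℕ} (Q : Fin K → Measure (Outcome D)) [∀ k, IsProbabilityMeasure (Q k)]

lemma leadingTerm_le (T : ℕ) {a : Arm K D} (ha : a ∈ subopt Q) :
    leadingTerm Q T a ≤ 27 * (waitTime a.2 * Real.log T / gap Q a) := by
  have hg := (mem_subopt Q a).1 ha
  have hg1 := gap_le_one Q a
  have hα := alpha_nonneg a.2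
  have hβ := beta_sq_le a.2
  have hR2 : √(beta a.2 ^ 2 + 2 * gap Q a * alpha a.2) ^ 2 =
      beta a.2 ^ 2 + 2 * gap Q a * alpha a.2 := Real.sq_sqrt (by positivity)
  -- `(β + R)² ≤ 2β² + 2R² = 4β² + 4Δα ≤ (16 + 32/3) j`, which is below `27 j`.
  have h1 : (beta a.2 + √(beta a.2 ^ 2 + 2 * gap Q a * alpha a.2)) ^ 2 ≤ 27 * waitTime a.2 := by
    have h2 : gap Q a * alpha a.2 ≤ alpha a.2 := mul_le_of_le_one_left hα hg1
    have h3 : alpha a.2 ≤ 8 / 3 * waitTime a.2 := by unfold alpha; linarith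
    nlinarith [sq_nonneg (beta a.2 - √(beta a.2 ^ 2 + 2 * gap Q a * alpha a.2)),
      (Nat.cast_nonneg (waitTime a.2) : (0 : ℝ) ≤ waitTime a.2)]
  unfold leadingTerm
  rw [← mul_div_assoc, ← mul_assoc]
  exact div_le_div_of_nonneg_right
    (mul_le_mul_of_nonneg_right h1 (Real.log_natCast_nonneg T)) hg.le

/-- Absorbs the additive constant into the logarithmic term: `j ≥ 1`, `Δ ≤ 1` and `13 log 2 > 7`. -/
lemma seven_le {T : ℕ} (hT : 2 ≤ T) {a : Arm K D} (ha : a ∈ subopt Q) :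
    7 ≤ 13 * (waitTime a.2 * Real.log T / gap Q a) := by
  have hg := (mem_subopt Q a).1 ha
  have hg1 := gap_le_one Q a
  have hj : (1 : ℝ) ≤ waitTime a.2 := by exact_mod_cast one_le_waitTime a.2
  have hlog : 0.6931471803 ≤ Real.log T :=
    Real.log_two_gt_d9.le.trans (Real.log_le_log (by norm_num) (by exact_mod_cast hT))
  have h1 : Real.log T ≤ waitTime a.2 * Real.log T / gap Q a := by
    rw [le_div_iff₀ hg]
    nlinarith
  linarith

lemma sum_subopt_le (T : ℕ) {Δ : ℝ} (hΔ : 0 < Δ) (h : ∀ a ∈ subopt Q, Δ ≤ gap Q a) :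
    ∑ a ∈ subopt Q, meanWait Q a * (waitTime a.2 * Real.log T / gap Q a) ≤
      K * (D : ℝ) ^ 3 / Δ * Real.log T := by
  have hlog := Real.log_natCast_nonneg T
  calc _ ≤ ∑ _a ∈ subopt Q, (D : ℝ) * (D * Real.log T / Δ) := by
        refine Finset.sum_le_sum fun a ha => ?_
        have hD : (waitTime a.2 : ℝ) ≤ D := by exact_mod_cast waitTime_le a.2
        have h1 := (meanWait_le Q a).trans hD
        have h2 := h a ha
        have h3 := hΔ.trans_le h2
        gcongr
    _ ≤ ∑ _a : Arm K D, (D : ℝ) * (D * Real.log T / Δ) :=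
        Finset.sum_le_sum_of_subset_of_nonneg (Finset.subset_univ _) fun _ _ _ => by positivity
    _ = _ := by
        simp
        ring

end Constants

end FarewellToArms

open FarewellToArms in
theorem theorem2 :
    ∃ C : ℝ, ∀ (K D T : ℕ) (rule : StopRule)
      (Q : Fin K → Measure (Outcome D)) (_ : ∀ k, IsProbabilityMeasure (Q k))
      (Ω : Type*) (m : MeasurableSpace Ω) (P : Measure Ω) (_ : IsProbabilityMeasure P)
      (ℱ : Filtration ℕ m) (X : ℕ → Fin K → Ω → Outcome D) (i : ℕ → Ω → Arm K D),
      IsEnvironment P ℱ Q X → IsWaitUCB ℱ X i T →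
        -- the bound, when some arm pair is suboptimal
        ((subopt Q).Nonempty →
          pseudoRegret P X i T rule ≤
            ∑ a ∈ subopt Q, meanWait Q a * (leadingTerm Q T a + C)) ∧
        -- the degenerate case in which the sum is empty
        (subopt Q = ∅ → pseudoRegret P X i T rule ≤ C) ∧
        -- the coarser form of the leading term and of the whole bound
        (∑ a ∈ subopt Q, meanWait Q a * leadingTerm Q T a ≤
          C * ∑ a ∈ subopt Q, meanWait Q a * (waitTime a.2 * Real.log T / gap Q a)) ∧
        ((subopt Q).Nonempty → 2 ≤ T →
          pseudoRegret P X i T rule ≤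
            C * ∑ a ∈ subopt Q, meanWait Q a * (waitTime a.2 * Real.log T / gap Q a)) ∧
        -- the worst-case form, with a lower bound for the gaps
        (∀ Δ : ℝ, 0 < Δ → (∀ a ∈ subopt Q, Δ ≤ gap Q a) →
          ∑ a ∈ subopt Q, meanWait Q a * (waitTime a.2 * Real.log T / gap Q a) ≤
              K * (D : ℝ) ^ 3 / Δ * Real.log T ∧
            ((subopt Q).Nonempty → 2 ≤ T →
              pseudoRegret P X i T rule ≤ C * (K * (D : ℝ) ^ 3 / Δ * Real.log T))) := by
  -- `40 = 27 + 13`: the leading term and the absorbed additive constant.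
  refine ⟨40, ?_⟩
  intro K D T rule Q hQ Ω m P hP ℱ X i hE hU
  have hreg := pseudoRegret_le hE hU rule
  have hmain : (subopt Q).Nonempty → pseudoRegret P X i T rule ≤
      ∑ a ∈ subopt Q, meanWait Q a * (leadingTerm Q T a + 7) := by
    rintro ⟨b, hb⟩
    -- Mean waits are at least 1, so one suboptimal pair suffices to move the additive 2 into the
    -- sum, turning 5 into 7.
    have h1 : (1 : ℝ) ≤ ∑ a ∈ subopt Q, meanWait Q a :=
      (one_le_meanWait Q b).trans (Finset.single_le_sum (f := meanWait Q)
        (fun a _ => zero_le_one.trans (one_le_meanWait Q a)) hb)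
    have h2 : ∑ a ∈ subopt Q, meanWait Q a * (leadingTerm Q T a + 7) =
        ∑ a ∈ subopt Q, meanWait Q a * (leadingTerm Q T a + 5) +
          2 * ∑ a ∈ subopt Q, meanWait Q a := by
      rw [Finset.mul_sum, ← Finset.sum_add_distrib]
      exact Finset.sum_congr rfl fun a _ => by ring
    linarith
  have hw : ∀ a, 0 ≤ meanWait Q a := fun a => zero_le_one.trans (one_le_meanWait Q a)
  have hq : ∀ a ∈ subopt Q, 0 ≤ waitTime a.2 * Real.log T / gap Q a := fun a _ =>
    div_nonneg (mul_nonneg (Nat.cast_nonneg _) (Real.log_natCast_nonneg T)) (gap_nonneg Q a)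
  have hcoarse : (subopt Q).Nonempty → 2 ≤ T → pseudoRegret P X i T rule ≤
      40 * ∑ a ∈ subopt Q, meanWait Q a * (waitTime a.2 * Real.log T / gap Q a) := by
    intro hne hT
    refine (hmain hne).trans ?_
    rw [Finset.mul_sum]
    refine Finset.sum_le_sum fun a ha => ?_
    rw [mul_left_comm]
    exact mul_le_mul_of_nonneg_left
      (by linarith [leadingTerm_le Q T ha, seven_le Q hT ha]) (hw a)
  refine ⟨fun hne => (hmain hne).trans ?_, fun he => ?_, ?_, hcoarse, fun Δ hΔ h => ?_⟩
  · exact Finset.sum_le_sum fun a _ => mul_le_mul_of_nonneg_left (by linarith) (hw a)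
  · rw [he, Finset.sum_empty] at hreg
    linarith
  · rw [Finset.mul_sum]
    refine Finset.sum_le_sum fun a ha => ?_
    rw [mul_left_comm]
    exact mul_le_mul_of_nonneg_left (by linarith [leadingTerm_le Q T ha, hq a ha]) (hw a)
  · have hs := sum_subopt_le Q T hΔ h
    exact ⟨hs, fun hne hT => (hcoarse hne hT).trans (by linarith)⟩
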